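/- Let $\mathbb K$ be a field of characteristic $0$. DG-vector spaces over $\mathbb K$ are $\mathbb Z$-graded cochain complexes (differential of degree $+1$); a DG-pair $(V,F)$ is a DG-vector space $V$ with a DG-subspace $F\subseteq V$. Let $\operatorname{End}^*(V)$ be the DG-Lie algebra of homogeneous endomorphisms of $V$ (graded commutator, differential $[d,-]$), and, with $\mathbb K$ in degree $0$, \[\operatorname{End}^*(V;F)=\{\xi\in\operatorname{End}^*(V)\mid \xi(F)\subseteq F\},\qquad \operatorname{Aff}(V)=\{\xi\in\operatorname{End}^*(V\oplus\mathbb K)\mid \xi(V\oplus\mathbb K)\subseteq V\},\] \[\operatorname{Aff}(V;F)=\{\xi\in\operatorname{End}^*(V\oplus\mathbb K)\mid \xi(V\oplus\mathbb K)\subseteq V,\ \xi(F\oplus\mathbb K)\subseteq F\}.\] The Jacobian square $\mathcal J(V,F)$ is the commutative square of DG-Lie algebras \[\begin{array}{ccc}\operatorname{End}^*(V;F)&\to&\operatorname{End}^*(V)\\ \downarrow&&\downarrow\\ \operatorname{Aff}(V;F)&\to&\operatorname{Aff}(V)\end{array}\] whose horizontal maps are the inclusions and whose vertical maps are $\xi\mapsto\xi\oplus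 0$. A commutative square of DG-Lie algebras $\mathfrak g_{00}\to\mathfrak g_{01}$, $\mathfrak g_{00}\to\mathfrak g_{10}$, $\mathfrak g_{01}\to\mathfrak g_{11}$, $\mathfrak g_{10}\to\mathfrak g_{11}$ is fibrant if $\mathfrak g_{01}\to\mathfrak g_{11}$, $\mathfrak g_{10}\to\mathfrak g_{11}$ and $\mathfrak g_{00}\to\mathfrak g_{10}\times_{\mathfrak g_{11}}\mathfrak g_{01}$ are surjective. A fibrant resolution of a square is an objectwise quasi-isomorphism of squares to a fibrant square $\tilde{\mathfrak g}_{\bullet\bullet}$, and the double homotopy fibre computed by it is the DG-Lie algebra $\ker(\tilde{\mathfrak g}_{00}\to\tilde{\mathfrak g}_{10}\times_{\tilde{\mathfrak g}_{11}}\tilde{\mathfrak g}_{01})$. Two DG-Lie algebras are homotopy equivalent if they are joined by a finite zigzag of quasi-isomorphisms of DG-Lie algebras, and a DG-Lie algebra is homotopy abelian if it is homotopy equivalent to one with zero bracket. The Jacobian DG-Lie algebra $\mathfrak J(V,F)$ is the double homotopy fibre of $\mathcal J(V,F)$. **Lemma.** Let $(V,F)$ be a DG-pair. Then $\mathfrak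 J(V,F)$ is homotopy abelian. More precisely, $\mathfrak J(V,F)$ is homotopy equivalent to the complex $(V/F)[-2]$ equipped with the trivial bracket. That is: $\mathcal J(V,F)$ has a fibrant resolution, and for every fibrant resolution of $\mathcal J(V,F)$ the double homotopy fibre computed by it is homotopy abelian and is homotopy equivalent to $(V/F)[-2]$ with trivial bracket. -/

import Mathlib

open CategoryTheory CategoryTheory.Limits CochainComplex CochainComplex.HomComplex

universe u

noncomputable section

/-! DG-vector spaces over `K` are Mathlib's `CochainComplex (ModuleCat K) ℤ`. -/

/-- A differential graded Lie algebra over `K`: a cochain complex with a bilinear bracket of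
degree `0` which is graded antisymmetric, satisfies the graded Jacobi identity, and for which the
differential is a derivation. The degree of a bracket is a free variable together with a proof
that it is the sum of the degrees. -/
structure DGLA (K : Type u) [Field K] where
  /-- the underlying cochain complex -/
  cx : CochainComplex (ModuleCat.{u} K) ℤ
  /-- the bracket `[x, y]` of `x` in degree `i` and `y` in degree `j` -/
  bracket (i j k : ℤ) (h : i + j = k) : cx.X i →ₗ[K] cx.X j →ₗ[K] cx.X k
  /-- `[x, y] = -(-1)^{ij} [y, x]` -/
  skew (i j k : ℤ) (h : i + j = k) (h' : j + i = k) (x : cx.X i) (y : cx.X j) :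
    bracket i j k h x y = -((i * j).negOnePow • bracket j i k h' y x)
  /-- `[x, [y, z]] = [[x, y], z] + (-1)^{ij} [y, [x, z]]` -/
  jacobi (i j l ij jl il n : ℤ) (hij : i + j = ij) (hjl : j + l = jl) (hil : i + l = il)
    (h₁ : i + jl = n) (h₂ : ij + l = n) (h₃ : j + il = n)
    (x : cx.X i) (y : cx.X j) (z : cx.X l) :
    bracket i jl n h₁ x (bracket j l jl hjl y z) =
      bracket ij l n h₂ (bracket i j ij hij x y) z +
        (i * j).negOnePow • bracket j il n h₃ y (bracket i l il hil x z)
  /-- `d [x, y] = [d x, y] + (-1)^i [x, d y]` -/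
  leibniz (i j k i' j' k' : ℤ) (h : i + j = k) (hi : i + 1 = i') (hj : j + 1 = j')
    (hk : k + 1 = k') (h₁ : i' + j = k') (h₂ : i + j' = k') (x : cx.X i) (y : cx.X j) :
    cx.d k k' (bracket i j k h x y) =
      bracket i' j k' h₁ (cx.d i i' x) y + i.negOnePow • bracket i j' k' h₂ x (cx.d j j' y)

namespace DGLA

variable {K : Type u} [Field K]

/-- A morphism of DG-Lie algebras. -/
structure Hom (L M : DGLA K) where
  /-- the underlying morphism of complexes -/
  toHom : L.cx ⟶ M.cx
  map_bracket (i j k : ℤ) (h : i + j = k) (x : L.cx.X i) (y : L.cx.X j) :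
    toHom.f k (L.bracket i j k h x y) = M.bracket i j k h (toHom.f i x) (toHom.f j y)

/-- Weak equivalences of DG-Lie algebras: the quasi-isomorphisms. -/
def Hom.IsWeakEquiv {L M : DGLA K} (f : Hom L M) : Prop := QuasiIso f.toHom

/-- Fibrations of DG-Lie algebras: the (degreewise) surjective morphisms. -/
def Hom.IsFibration {L M : DGLA K} (f : Hom L M) : Prop :=
  ∀ i : ℤ, Function.Surjective (f.toHom.f i)

/-- Two DG-Lie algebras are homotopy equivalent if they are joined by a (finite) zigzag of
quasi-isomorphisms of DG-Lie algebras. -/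
def HomotopyEquivalent (L M : DGLA K) : Prop :=
  Relation.EqvGen (fun A B : DGLA K => ∃ f : Hom A B, f.IsWeakEquiv) L M

/-- A DG-Lie algebra is abelian if its bracket vanishes. -/
def IsAbelian (L : DGLA K) : Prop := ∀ i j k h, L.bracket i j k h = 0

/-- A DG-Lie algebra is homotopy abelian if it is homotopy equivalent to an abelian one. -/
def IsHomotopyAbelian (L : DGLA K) : Prop :=
  ∃ M : DGLA K, M.IsAbelian ∧ HomotopyEquivalent L M

/-- A complex, equipped with the trivial bracket. -/
def trivialBracket (C : CochainComplex (ModuleCat.{u} K) ℤ) : DGLA K where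
  cx := C
  bracket _ _ _ _ := 0
  skew := by simp
  jacobi := by simp
  leibniz := by simp

end DGLA

/-- A DG-subspace of a DG-vector space `V`. Together, `V` and `F` form a DG-pair `(V, F)`. -/
structure DGSubspace {K : Type u} [Field K] (V : CochainComplex (ModuleCat.{u} K) ℤ) where
  /-- the degree `i` part -/
  carrier (i : ℤ) : Submodule K (V.X i)
  d_mem (i j : ℤ) (x : V.X i) (hx : x ∈ carrier i) : V.d i j x ∈ carrier j

namespace DGSubspace

variable {K : Type u} [Field K] {V : CochainComplex (ModuleCat.{u} K) ℤ}

/-- The DG-subspace `F`, as a complex of its own. -/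
def toComplex (F : DGSubspace V) : CochainComplex (ModuleCat.{u} K) ℤ where
  X i := ModuleCat.of K (F.carrier i)
  d i j := ModuleCat.ofHom ((V.d i j).hom.restrict (F.d_mem i j))
  shape i j h := by
    ext x
    change V.d i j x.1 = 0
    simp [V.shape i j h]
  d_comp_d' i j k _ _ := by
    ext x
    change V.d j k (V.d i j x.1) = 0
    simp [← ModuleCat.comp_apply]

/-- The quotient complex `V / F`. -/
def quotient (F : DGSubspace V) : CochainComplex (ModuleCat.{u} K) ℤ where
  X i := ModuleCat.of K (V.X i ⧸ F.carrier i)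
  d i j := ModuleCat.ofHom ((F.carrier i).mapQ (F.carrier j) (V.d i j).hom (F.d_mem i j))
  shape i j h := by
    ext x
    simp [V.shape i j h]
  d_comp_d' i j k _ _ := by
    ext x
    simp [← ModuleCat.comp_apply]

/-- The whole of `V`. -/
def top (V : CochainComplex (ModuleCat.{u} K) ℤ) : DGSubspace V where
  carrier _ := ⊤
  d_mem _ _ _ _ := Submodule.mem_top

/-- The zero subspace of `V`. -/
def bot (V : CochainComplex (ModuleCat.{u} K) ℤ) : DGSubspace V where
  carrier _ := ⊥
  d_mem i j x hx := by
    rw [Submodule.mem_bot] at hx ⊢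
    rw [hx, map_zero]

/-- The intersection of two DG-subspaces. -/
def inter (F G : DGSubspace V) : DGSubspace V where
  carrier i := F.carrier i ⊓ G.carrier i
  d_mem i j x hx := ⟨F.d_mem i j x hx.1, G.d_mem i j x hx.2⟩

/-- The preimage of a DG-subspace under a morphism of complexes. -/
def preimage {W : CochainComplex (ModuleCat.{u} K) ℤ} (f : W ⟶ V) (F : DGSubspace V) :
    DGSubspace W where
  carrier i := (F.carrier i).comap (f.f i).hom
  d_mem i j x hx := by
    have e : V.d i j (f.f i x) = f.f j (W.d i j x) := ConcreteCategory.congr_hom (f.comm i j) x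
    change f.f j (W.d i j x) ∈ F.carrier j
    rw [← e]
    exact F.d_mem i j _ hx

end DGSubspace

/-- A sub-DG-Lie algebra: a DG-subspace closed under the bracket. -/
structure SubDGLA {K : Type u} [Field K] (L : DGLA K) extends DGSubspace L.cx where
  bracket_mem (i j k : ℤ) (h : i + j = k) (x : L.cx.X i) (y : L.cx.X j)
    (hx : x ∈ carrier i) (hy : y ∈ carrier j) : L.bracket i j k h x y ∈ carrier k

namespace SubDGLA

variable {K : Type u} [Field K] {L : DGLA K}

/-- A sub-DG-Lie algebra, as a DG-Lie algebra of its own. -/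
def toDGLA (S : SubDGLA L) : DGLA K where
  cx := S.toDGSubspace.toComplex
  bracket i j k h := LinearMap.mk₂ K
    (fun (x : S.carrier i) (y : S.carrier j) =>
      (⟨L.bracket i j k h x y, S.bracket_mem i j k h x y x.2 y.2⟩ : S.carrier k))
    (fun x x' y => Subtype.ext (LinearMap.map_add₂ (L.bracket i j k h) x.1 x'.1 y.1))
    (fun c x y => Subtype.ext (LinearMap.map_smul₂ (L.bracket i j k h) c x.1 y.1))
    (fun x y y' => Subtype.ext ((L.bracket i j k h x.1).map_add y.1 y'.1))
    (fun c x y => Subtype.ext ((L.bracket i j k h x.1).map_smul c y.1))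
  skew i j k h h' x y := Subtype.ext (L.skew i j k h h' x.1 y.1)
  jacobi i j l ij jl il n hij hjl hil h₁ h₂ h₃ x y z :=
    Subtype.ext (L.jacobi i j l ij jl il n hij hjl hil h₁ h₂ h₃ x.1 y.1 z.1)
  leibniz i j k i' j' k' h hi hj hk h₁ h₂ x y :=
    Subtype.ext (L.leibniz i j k i' j' k' h hi hj hk h₁ h₂ x.1 y.1)

/-- The intersection of two sub-DG-Lie algebras. -/
def inter (S T : SubDGLA L) : SubDGLA L where
  toDGSubspace := S.toDGSubspace.inter T.toDGSubspace
  bracket_mem i j k h x y hx hy :=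
    ⟨S.bracket_mem i j k h x y hx.1 hy.1, T.bracket_mem i j k h x y hx.2 hy.2⟩

/-- A morphism of DG-Lie algebras with image in `T` restricts to a morphism into `T`. -/
def codRestrictHom {M : DGLA K} (T : SubDGLA M) (f : DGLA.Hom L M)
    (hf : ∀ i x, f.toHom.f i x ∈ T.carrier i) : DGLA.Hom L T.toDGLA where
  toHom :=
    { f := fun i => ModuleCat.ofHom ((f.toHom.f i).hom.codRestrict (T.carrier i) (hf i))
      comm' := fun i j _ => by
        ext x
        apply Subtype.ext
        exact ConcreteCategory.congr_hom (f.toHom.comm i j) x }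
  map_bracket i j k h x y := Subtype.ext (f.map_bracket i j k h x y)

/-- A morphism of DG-Lie algebras that maps `S` into `T` restricts to a morphism `S → T`. -/
def restrictHom {M : DGLA K} (S : SubDGLA L) (T : SubDGLA M) (f : DGLA.Hom L M)
    (hf : ∀ i x, x ∈ S.carrier i → f.toHom.f i x ∈ T.carrier i) :
    DGLA.Hom S.toDGLA T.toDGLA where
  toHom :=
    { f := fun i => ModuleCat.ofHom ((f.toHom.f i).hom.restrict (hf i))
      comm' := fun i j _ => by
        ext x
        apply Subtype.ext
        exact ConcreteCategory.congr_hom (f.toHom.comm i j) x.1 }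
  map_bracket i j k h x y := Subtype.ext (f.map_bracket i j k h x.1 y.1)

/-- The inclusion of a sub-DG-Lie algebra into a larger one. -/
def inclusion (S T : SubDGLA L) (hST : ∀ i, S.carrier i ≤ T.carrier i) :
    DGLA.Hom S.toDGLA T.toDGLA where
  toHom :=
    { f := fun i => ModuleCat.ofHom (Submodule.inclusion (hST i))
      comm' := fun i j _ => by
        ext x
        rfl }
  map_bracket _ _ _ _ _ _ := rfl

/-- The inclusion of a sub-DG-Lie algebra. -/
def incl (S : SubDGLA L) : DGLA.Hom S.toDGLA L where
  toHom :=
    { f := fun i => ModuleCat.ofHom (S.carrier i).subtype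
      comm' := fun i j _ => by
        ext x
        rfl }
  map_bracket _ _ _ _ _ _ := rfl

end SubDGLA

section Squares

variable {K : Type u} [Field K]

/-- A commutative square of DG-Lie algebras
```
  g₀₀ --h₀--> g₀₁
   |           |
   v₀          v₁
   |           |
  g₁₀ --h₁--> g₁₁
``` -/
structure DGLASquare (K : Type u) [Field K] where
  g₀₀ : DGLA K
  g₀₁ : DGLA K
  g₁₀ : DGLA K
  g₁₁ : DGLA K
  h₀ : DGLA.Hom g₀₀ g₀₁
  v₀ : DGLA.Hom g₀₀ g₁₀
  v₁ : DGLA.Hom g₀₁ g₁₁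
  h₁ : DGLA.Hom g₁₀ g₁₁
  comm : h₀.toHom ≫ v₁.toHom = v₀.toHom ≫ h₁.toHom

namespace DGLASquare

/-- A morphism of commutative squares of DG-Lie algebras. -/
structure Hom (S T : DGLASquare K) where
  f₀₀ : DGLA.Hom S.g₀₀ T.g₀₀
  f₀₁ : DGLA.Hom S.g₀₁ T.g₀₁
  f₁₀ : DGLA.Hom S.g₁₀ T.g₁₀
  f₁₁ : DGLA.Hom S.g₁₁ T.g₁₁
  comm_h₀ : S.h₀.toHom ≫ f₀₁.toHom = f₀₀.toHom ≫ T.h₀.toHom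
  comm_v₀ : S.v₀.toHom ≫ f₁₀.toHom = f₀₀.toHom ≫ T.v₀.toHom
  comm_v₁ : S.v₁.toHom ≫ f₁₁.toHom = f₀₁.toHom ≫ T.v₁.toHom
  comm_h₁ : S.h₁.toHom ≫ f₁₁.toHom = f₁₀.toHom ≫ T.h₁.toHom

/-- Weak equivalences of squares: the objectwise quasi-isomorphisms. -/
def Hom.IsWeakEquiv {S T : DGLASquare K} (f : Hom S T) : Prop :=
  f.f₀₀.IsWeakEquiv ∧ f.f₀₁.IsWeakEquiv ∧ f.f₁₀.IsWeakEquiv ∧ f.f₁₁.IsWeakEquiv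

/-- A square is fibrant (in the inverse Reedy model structure) if `g₀₁ → g₁₁`, `g₁₀ → g₁₁` and
`g₀₀ → g₁₀ ×_{g₁₁} g₀₁` are fibrations, i.e. surjective in every degree. -/
def IsFibrant (S : DGLASquare K) : Prop :=
  S.v₁.IsFibration ∧ S.h₁.IsFibration ∧
    ∀ (i : ℤ) (x : S.g₁₀.cx.X i) (y : S.g₀₁.cx.X i),
      S.h₁.toHom.f i x = S.v₁.toHom.f i y →
        ∃ z : S.g₀₀.cx.X i, S.v₀.toHom.f i z = x ∧ S.h₀.toHom.f i z = y

/-- The double fiber of a square, `ker (g₀₀ → g₁₀ ×_{g₁₁} g₀₁)`, as a sub-DG-Lie algebra of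
`g₀₀`. -/
def fib₂Sub (S : DGLASquare K) : SubDGLA S.g₀₀ where
  carrier i := LinearMap.ker (S.v₀.toHom.f i).hom ⊓ LinearMap.ker (S.h₀.toHom.f i).hom
  d_mem i j x hx := by
    have e₁ := ConcreteCategory.congr_hom (S.v₀.toHom.comm i j) x
    have e₂ := ConcreteCategory.congr_hom (S.h₀.toHom.comm i j) x
    simp only [Submodule.mem_inf, LinearMap.mem_ker] at hx ⊢
    simp only [ModuleCat.comp_apply] at e₁ e₂
    exact ⟨by rw [← e₁, hx.1, map_zero], by rw [← e₂, hx.2, map_zero]⟩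
  bracket_mem i j k h x y hx hy := by
    simp only [Submodule.mem_inf, LinearMap.mem_ker] at hx hy ⊢
    rw [S.v₀.map_bracket, S.h₀.map_bracket, hx.1, hx.2]
    simp

/-- The double fiber `fib^{[2]}` of a square. -/
def fib₂ (S : DGLASquare K) : DGLA K := S.fib₂Sub.toDGLA

/-- A fibrant resolution of a square: a weak equivalence to a fibrant square. -/
structure FibrantResolution (S : DGLASquare K) where
  target : DGLASquare K
  map : Hom S target
  isWeakEquiv : map.IsWeakEquiv
  isFibrant : target.IsFibrant

/-- The double homotopy fiber `hofib^{[2]}` of a square, as computed by a fibrant resolution. -/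
def FibrantResolution.hofib₂ {S : DGLASquare K} (R : S.FibrantResolution) : DGLA K :=
  R.target.fib₂

end DGLASquare

end Squares

section Endomorphisms

variable {K : Type u} [Field K]

/-- The graded commutator `x ∘ y - (-1)^{ij} y ∘ x` of homogeneous endomorphisms of a complex.
(`Cochain.comp` is composition in diagrammatic order.) -/
def gradedCommutator (W : CochainComplex (ModuleCat.{u} K) ℤ) (i j k : ℤ) (h : i + j = k)
    (x : Cochain W W i) (y : Cochain W W j) : Cochain W W k :=
  y.comp x (by omega) - (i * j).negOnePow • x.comp y h

theorem gradedCommutator_skew (W : CochainComplex (ModuleCat.{u} K) ℤ) (i j k : ℤ)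
    (h : i + j = k) (h' : j + i = k) (x : Cochain W W i) (y : Cochain W W j) :
    gradedCommutator W i j k h x y =
      -((i * j).negOnePow • gradedCommutator W j i k h' y x) := by
  unfold gradedCommutator
  rw [smul_sub, smul_smul, mul_comm j i, Int.units_mul_self, one_smul]
  abel

theorem gradedCommutator_jacobi (W : CochainComplex (ModuleCat.{u} K) ℤ)
    (i j l ij jl il n : ℤ) (hij : i + j = ij) (hjl : j + l = jl) (hil : i + l = il)
    (h₁ : i + jl = n) (h₂ : ij + l = n) (h₃ : j + il = n)
    (x : Cochain W W i) (y : Cochain W W j) (z : Cochain W W l) :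
    gradedCommutator W i jl n h₁ x (gradedCommutator W j l jl hjl y z) =
      gradedCommutator W ij l n h₂ (gradedCommutator W i j ij hij x y) z +
        (i * j).negOnePow •
          gradedCommutator W j il n h₃ y (gradedCommutator W i l il hil x z) := by
  subst hij hjl hil h₁
  unfold gradedCommutator
  simp only [Cochain.comp_sub, Cochain.sub_comp, Cochain.comp_units_smul,
    Cochain.units_smul_comp]
  rw [Cochain.comp_assoc z y x (by omega : l + j = j + l) (by omega : j + i = i + j) (by omega),
    Cochain.comp_assoc y z x (by omega : j + l = j + l) (by omega : l + i = i + l) (by omega),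
    Cochain.comp_assoc y x z (by omega : j + i = i + j) (by omega : i + l = i + l) (by omega),
    Cochain.comp_assoc x y z (by omega : i + j = i + j) (by omega : j + l = j + l) (by omega),
    Cochain.comp_assoc z x y (by omega : l + i = i + l) (by omega : i + j = i + j) (by omega),
    Cochain.comp_assoc x z y (by omega : i + l = i + l) (by omega : l + j = j + l) (by omega)]
  simp only [smul_sub, smul_smul, mul_add, add_mul, Int.negOnePow_add, mul_comm j i]
  rcases Int.units_eq_one_or (i * j).negOnePow with ha | ha <;>
  rcases Int.units_eq_one_or (i * l).negOnePow with hb | hb <;>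
  rcases Int.units_eq_one_or (j * l).negOnePow with hc | hc <;>
  · simp only [ha, hb, hc, mul_one, one_smul, mul_neg, neg_neg, Units.neg_smul]
    abel

theorem gradedCommutator_leibniz (W : CochainComplex (ModuleCat.{u} K) ℤ)
    (i j k i' j' k' : ℤ) (h : i + j = k) (hi : i + 1 = i') (hj : j + 1 = j')
    (hk : k + 1 = k') (h₁ : i' + j = k') (h₂ : i + j' = k')
    (x : Cochain W W i) (y : Cochain W W j) :
    δ k k' (gradedCommutator W i j k h x y) =
      gradedCommutator W i' j k' h₁ (δ i i' x) y +
        i.negOnePow • gradedCommutator W i j' k' h₂ x (δ j j' y) := by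
  unfold gradedCommutator
  rw [δ_sub, δ_units_smul, δ_comp y x (by omega) j' i' k' hk hj hi,
    δ_comp x y h i' j' k' hk hi hj]
  subst hi hj
  simp only [smul_sub, smul_add, smul_smul, mul_add, add_mul, Int.negOnePow_add, one_mul,
    mul_one]
  rcases Int.units_eq_one_or (i * j).negOnePow with ha | ha <;>
  rcases Int.units_eq_one_or i.negOnePow with hb | hb <;>
  rcases Int.units_eq_one_or j.negOnePow with hc | hc <;>
  · simp only [ha, hb, hc, mul_one, one_smul, mul_neg, neg_neg, Units.neg_smul]
    abel

/-- The DG-Lie algebra `End^*(W)` of homogeneous endomorphisms of a DG-vector space `W`, with the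
differential `x ↦ d ∘ x - (-1)^{deg x} x ∘ d` and the graded commutator. -/
def endDGLA (W : CochainComplex (ModuleCat.{u} K) ℤ) : DGLA K where
  cx :=
    { X := fun i => ModuleCat.of K (Cochain W W i)
      d := fun i j => ModuleCat.ofHom (δ_hom K W W i j)
      shape := fun i j h => by
        ext : 1
        exact LinearMap.ext fun x => δ_shape i j h x
      d_comp_d' := fun i j k _ _ => by
        ext : 1
        exact LinearMap.ext fun x => δ_δ i j k x }
  bracket i j k h := LinearMap.mk₂ K (gradedCommutator W i j k h)
    (fun x x' y => by
      simp only [gradedCommutator, Cochain.comp_add, Cochain.add_comp, smul_add]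
      abel)
    (fun c x y => by
      simp only [gradedCommutator, Cochain.comp_smul, Cochain.smul_comp, smul_sub]
      rw [smul_comm])
    (fun x y y' => by
      simp only [gradedCommutator, Cochain.comp_add, Cochain.add_comp, smul_add]
      abel)
    (fun c x y => by
      simp only [gradedCommutator, Cochain.comp_smul, Cochain.smul_comp, smul_sub]
      rw [smul_comm])
  skew := gradedCommutator_skew W
  jacobi := gradedCommutator_jacobi W
  leibniz := gradedCommutator_leibniz W

/-- For families `P`, `Q` of subspaces of a complex `W` with `Q ≤ P` that are both stable under
the differential, the endomorphisms of `W` that map `P` into `Q`, as a sub-DG-Lie algebra of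
`End^*(W)`. -/
def mapsIntoSub (W : CochainComplex (ModuleCat.{u} K) ℤ) (P Q : DGSubspace W)
    (hQP : ∀ i, Q.carrier i ≤ P.carrier i) : SubDGLA (endDGLA W) where
  carrier n :=
    { carrier := {ξ : Cochain W W n | ∀ (p q : ℤ) (h : p + n = q) (x : W.X p),
        x ∈ P.carrier p → ξ.v p q h x ∈ Q.carrier q}
      add_mem' := fun {ξ η} hξ hη p q h x hx =>
        (Q.carrier q).add_mem (hξ p q h x hx) (hη p q h x hx)
      zero_mem' := fun p q h x hx => (Q.carrier q).zero_mem
      smul_mem' := fun c ξ hξ p q h x hx => (Q.carrier q).smul_mem c (hξ p q h x hx) }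
  d_mem i j (ξ : Cochain W W i) hξ := by
    intro p q h x hx
    change (δ i j ξ).v p q h x ∈ Q.carrier q
    by_cases hij : i + 1 = j
    · rw [δ_v i j hij ξ p q h (q - 1) (p + 1) rfl rfl]
      refine (Q.carrier q).add_mem ?_ ?_
      · exact Q.d_mem _ _ _ (hξ _ _ _ x hx)
      · rcases Int.units_eq_one_or j.negOnePow with e | e <;> rw [e]
        · rw [one_smul]
          exact hξ _ _ _ _ (P.d_mem _ _ _ hx)
        · rw [Units.neg_smul, one_smul]
          exact (Q.carrier q).neg_mem (hξ _ _ _ _ (P.d_mem _ _ _ hx))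
    · rw [δ_shape i j hij]
      exact (Q.carrier q).zero_mem
  bracket_mem i j k h (ξ : Cochain W W i) (η : Cochain W W j) hξ hη := by
    intro p q hpq x hx
    change (gradedCommutator W i j k h ξ η).v p q hpq x ∈ Q.carrier q
    have e₁ : (η.comp ξ (by omega : j + i = k)).v p q hpq x ∈ Q.carrier q := by
      rw [Cochain.comp_v η ξ _ p (p + j) q rfl (by omega)]
      exact hξ _ _ _ _ (hQP _ (hη _ _ _ _ hx))
    have e₂ : (ξ.comp η h).v p q hpq x ∈ Q.carrier q := by
      rw [Cochain.comp_v ξ η _ p (p + i) q rfl (by omega)]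
      exact hη _ _ _ _ (hQP _ (hξ _ _ _ _ hx))
    refine (Q.carrier q).sub_mem e₁ ?_
    rcases Int.units_eq_one_or (i * j).negOnePow with e | e <;> rw [e]
    · rw [one_smul]
      exact e₂
    · rw [Units.neg_smul, one_smul]
      exact (Q.carrier q).neg_mem e₂

/-- `End^*(V; F)`: the endomorphisms of `V` that map `F` to itself. -/
def endSub (V : CochainComplex (ModuleCat.{u} K) ℤ) (F : DGSubspace V) : SubDGLA (endDGLA V) :=
  mapsIntoSub V F F (fun _ => le_rfl)

/-- The DG-vector space `V ⊕ K`, where `K` sits in degree `0`. -/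
def plusUnit (V : CochainComplex (ModuleCat.{u} K) ℤ) : CochainComplex (ModuleCat.{u} K) ℤ :=
  V ⊞ (CochainComplex.singleFunctor (ModuleCat.{u} K) 0).obj (ModuleCat.of K K)

/-- The projection `V ⊕ K → V`. -/
def plusUnitFst (V : CochainComplex (ModuleCat.{u} K) ℤ) : plusUnit V ⟶ V := biprod.fst

/-- The projection `V ⊕ K → K`. -/
def plusUnitSnd (V : CochainComplex (ModuleCat.{u} K) ℤ) :
    plusUnit V ⟶ (CochainComplex.singleFunctor (ModuleCat.{u} K) 0).obj (ModuleCat.of K K) :=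
  biprod.snd

/-- The inclusion `V → V ⊕ K`. -/
def plusUnitInl (V : CochainComplex (ModuleCat.{u} K) ℤ) : V ⟶ plusUnit V := biprod.inl

theorem plusUnitInl_fst (V : CochainComplex (ModuleCat.{u} K) ℤ) :
    plusUnitInl V ≫ plusUnitFst V = 𝟙 V := biprod.inl_fst

theorem plusUnitInl_snd (V : CochainComplex (ModuleCat.{u} K) ℤ) :
    plusUnitInl V ≫ plusUnitSnd V = 0 := biprod.inl_snd

/-- The DG-subspace `V` of `V ⊕ K`: the kernel of the projection to `K`. -/
def vecSubspace (V : CochainComplex (ModuleCat.{u} K) ℤ) : DGSubspace (plusUnit V) :=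
  (DGSubspace.bot _).preimage (plusUnitSnd V)

/-- The DG-subspace `F ⊕ K` of `V ⊕ K`. -/
def DGSubspace.plusUnit {V : CochainComplex (ModuleCat.{u} K) ℤ} (F : DGSubspace V) :
    DGSubspace (_root_.plusUnit V) :=
  F.preimage (plusUnitFst V)

/-- The DG-subspace `F` of `V ⊕ K`. -/
def DGSubspace.inPlusUnit {V : CochainComplex (ModuleCat.{u} K) ℤ} (F : DGSubspace V) :
    DGSubspace (_root_.plusUnit V) :=
  F.plusUnit.inter (vecSubspace V)

/-- `Aff(V)`: the `ξ` in `End^*(V ⊕ K)` with `ξ (V ⊕ K) ⊆ V`. -/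
def affSub (V : CochainComplex (ModuleCat.{u} K) ℤ) : SubDGLA (endDGLA (plusUnit V)) :=
  mapsIntoSub (plusUnit V) (DGSubspace.top _) (vecSubspace V) (fun _ => le_top)

/-- `Aff(V; F)`: the `ξ` in `End^*(V ⊕ K)` with `ξ (V ⊕ K) ⊆ V` and `ξ (F ⊕ K) ⊆ F`. -/
def affPairSub (V : CochainComplex (ModuleCat.{u} K) ℤ) (F : DGSubspace V) :
    SubDGLA (endDGLA (plusUnit V)) :=
  (affSub V).inter
    (mapsIntoSub (plusUnit V) F.plusUnit F.inPlusUnit (fun _ => inf_le_left))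

/-- The extension by zero `ξ ↦ ξ ⊕ 0` of endomorphisms of `V` to endomorphisms of `V ⊕ K`. -/
def extendCochain (V : CochainComplex (ModuleCat.{u} K) ℤ) (n : ℤ) (ξ : Cochain V V n) :
    Cochain (plusUnit V) (plusUnit V) n :=
  ((Cochain.ofHom (plusUnitFst V)).comp ξ (zero_add n)).comp
    (Cochain.ofHom (plusUnitInl V)) (add_zero n)

theorem extendCochain_v (V : CochainComplex (ModuleCat.{u} K) ℤ) (n : ℤ) (ξ : Cochain V V n)
    (p q : ℤ) (h : p + n = q) :
    (extendCochain V n ξ).v p q h =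
      (plusUnitFst V).f p ≫ ξ.v p q h ≫ (plusUnitInl V).f q := by
  simp [extendCochain]

theorem extendCochain_comp (V : CochainComplex (ModuleCat.{u} K) ℤ) (i j k : ℤ) (h : i + j = k)
    (ξ : Cochain V V i) (η : Cochain V V j) :
    (extendCochain V i ξ).comp (extendCochain V j η) h = extendCochain V k (ξ.comp η h) := by
  ext p q hpq
  have e : (plusUnitInl V).f (p + i) ≫ (plusUnitFst V).f (p + i) = 𝟙 _ := by
    rw [← HomologicalComplex.comp_f, plusUnitInl_fst, HomologicalComplex.id_f]
  rw [Cochain.comp_v _ _ h p (p + i) q rfl (by omega), extendCochain_v, extendCochain_v,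
    extendCochain_v, Cochain.comp_v _ _ h p (p + i) q rfl (by omega)]
  simp only [Category.assoc]
  rw [reassoc_of% e]

theorem δ_extendCochain (V : CochainComplex (ModuleCat.{u} K) ℤ) (i j : ℤ) (ξ : Cochain V V i) :
    δ i j (extendCochain V i ξ) = extendCochain V j (δ i j ξ) := by
  simp [extendCochain]

theorem fst_extendCochain (V : CochainComplex (ModuleCat.{u} K) ℤ) (n : ℤ) (ξ : Cochain V V n)
    (p q : ℤ) (h : p + n = q) (x : (plusUnit V).X p) :
    (plusUnitFst V).f q ((extendCochain V n ξ).v p q h x) =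
      ξ.v p q h ((plusUnitFst V).f p x) := by
  have e : (plusUnitInl V).f q ≫ (plusUnitFst V).f q = 𝟙 _ := by
    rw [← HomologicalComplex.comp_f, plusUnitInl_fst, HomologicalComplex.id_f]
  rw [extendCochain_v, ← ModuleCat.comp_apply]
  simp only [Category.assoc, e, Category.comp_id]
  rfl

theorem snd_extendCochain (V : CochainComplex (ModuleCat.{u} K) ℤ) (n : ℤ) (ξ : Cochain V V n)
    (p q : ℤ) (h : p + n = q) (x : (plusUnit V).X p) :
    (plusUnitSnd V).f q ((extendCochain V n ξ).v p q h x) = 0 := by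
  have e : (plusUnitInl V).f q ≫ (plusUnitSnd V).f q = 0 := by
    rw [← HomologicalComplex.comp_f, plusUnitInl_snd, HomologicalComplex.zero_f]
  rw [extendCochain_v, ← ModuleCat.comp_apply]
  simp only [Category.assoc, e, comp_zero]
  rfl

/-- Extension by zero, as a morphism of DG-Lie algebras `End^*(V) → End^*(V ⊕ K)`. -/
def extendHom (V : CochainComplex (ModuleCat.{u} K) ℤ) :
    DGLA.Hom (endDGLA V) (endDGLA (plusUnit V)) where
  toHom :=
    { f := fun n => ModuleCat.ofHom
        { toFun := extendCochain V n
          map_add' := fun ξ η => by simp [extendCochain]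
          map_smul' := fun c ξ => by simp [extendCochain] }
      comm' := fun i j _ => by
        ext ξ
        exact δ_extendCochain V i j ξ }
  map_bracket i j k h (ξ : Cochain V V i) (η : Cochain V V j) := by
    change extendCochain V k (gradedCommutator V i j k h ξ η) =
      gradedCommutator _ i j k h (extendCochain V i ξ) (extendCochain V j η)
    simp only [gradedCommutator, extendCochain_comp]
    simp [extendCochain]

theorem extendHom_mem_affSub (V : CochainComplex (ModuleCat.{u} K) ℤ) (n : ℤ)
    (ξ : (endDGLA V).cx.X n) : (extendHom V).toHom.f n ξ ∈ (affSub V).carrier n :=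
  fun p q h x _ => snd_extendCochain V n ξ p q h x

theorem extendHom_mem_affPairSub (V : CochainComplex (ModuleCat.{u} K) ℤ) (F : DGSubspace V)
    (n : ℤ) (ξ : (endDGLA V).cx.X n) (hξ : ξ ∈ (endSub V F).carrier n) :
    (extendHom V).toHom.f n ξ ∈ (affPairSub V F).carrier n := by
  refine ⟨extendHom_mem_affSub V n ξ, fun p q h x hx => ⟨?_, snd_extendCochain V n ξ p q h x⟩⟩
  have e := fst_extendCochain V n ξ p q h x
  have e' := hξ p q h _ hx
  exact (congrArg (· ∈ F.carrier q) e).mpr e'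

/-- The Jacobian square of a DG-pair `(V, F)`. The horizontal maps are the inclusions, the
vertical maps are `ξ ↦ ξ ⊕ 0`:
```
  End^*(V; F) ---> End^*(V)
      |               |
   Aff(V; F) ---->  Aff(V)
``` -/
def jacobianSquare (V : CochainComplex (ModuleCat.{u} K) ℤ) (F : DGSubspace V) :
    DGLASquare K where
  g₀₀ := (endSub V F).toDGLA
  g₀₁ := endDGLA V
  g₁₀ := (affPairSub V F).toDGLA
  g₁₁ := (affSub V).toDGLA
  h₀ := (endSub V F).incl
  v₀ := (endSub V F).restrictHom (affPairSub V F) (extendHom V) (extendHom_mem_affPairSub V F)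
  v₁ := (affSub V).codRestrictHom (extendHom V) (extendHom_mem_affSub V)
  h₁ := (affPairSub V F).inclusion (affSub V) (fun _ => inf_le_left)
  comm := rfl

end Endomorphisms

end

/-! An element of `Aff(V)` is an endomorphism of `V` extended by zero plus a translation `(v, c) ↦ c
x`, and the translations form a subcomplex isomorphic to `V`. Hence, as complexes, `Aff(V) =
End^*(V) ⊕ V` and likewise `Aff(V; F) = End^*(V; F) ⊕ F`. The homotopy fibres of the vertical maps
of the Jacobian square are therefore `V[-1]` and `F[-1]`, and the homotopy fibre of `F[-1] → V[-1]`
is `(V/F)[-2]`.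

The brackets disappear because the quasi-isomorphisms can be written down inside path objects. The
homotopy fibre of `f : B → A` is modelled by pairs `(b, γ)` with `γ` in `A[t, dt]`, `γ(0) = 0` and
`γ(1) = f(b)`. If `A = f(B) ⊕ φ(C)` as complexes, then `c ↦ (0, dt φ(c))` is a quasi-isomorphism
from `C[-1]` to this model (`isWeakEquiv_dtHofib`). It is a morphism from the trivial bracket
because `dt · dt = 0`, whatever the bracket of `A` does on `φ(C)`. For both vertical maps, these
morphisms are compatible with the horizontal maps of the square on the nose.

In characteristic 0 polynomials can be integrated, so closed paths starting at 0 have primitives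
starting at 0 (`exists_path_primitive`). With this Poincaré lemma every quasi-isomorphism claim
about path objects becomes a lifting problem for elements. The main instance is
`isWeakEquiv_hofibMap`: a homotopy cartesian square induces a quasi-isomorphism of homotopy fibres.
It yields invariance of the iterated homotopy fibre under weak equivalences of squares, and also the
passage from `F[-1] → V[-1]` to `0 → (V/F)[-1]`.

For a fibrant square the strict double fibre is the kernel of a surjection between kernels of
surjections. Kernels of surjections are quasi-isomorphic to homotopy fibres (`isWeakEquiv_toHofib`),
so the double fibre of any fibrant resolution is homotopy equivalent to the iterated homotopy fibre
of the original square. A fibrant resolution exists because each map can be replaced by evaluation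
on its mapping path space. -/

/-! ### Quasi-isomorphisms in terms of elements -/

theorem CategoryTheory.ShortComplex.moduleCat_quasiIso_iff {R : Type u} [Ring R]
    {S T : ShortComplex (ModuleCat.{u} R)} (φ : S ⟶ T) :
    ShortComplex.QuasiIso φ ↔
      (∀ (x : S.X₂) (y : T.X₁), S.g x = 0 → φ.τ₂ x = T.f y → ∃ x' : S.X₁, S.f x' = x) ∧
      (∀ y : T.X₂, T.g y = 0 → ∃ (x : S.X₂) (y' : T.X₁), S.g x = 0 ∧ φ.τ₂ x + T.f y' = y) := by
  let γ : ShortComplex.LeftHomologyMapData φ S.moduleCatLeftHomologyData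
    T.moduleCatLeftHomologyData := default
  have hK (x : LinearMap.ker S.g.hom) : (γ.φK x : LinearMap.ker T.g.hom).1 = φ.τ₂ x.1 :=
    congrArg (fun f => f.hom x) γ.commi
  have hH (x : LinearMap.ker S.g.hom) :
      γ.φH (Submodule.Quotient.mk (p := LinearMap.range S.moduleCatToCycles) x) =
        Submodule.Quotient.mk (p := LinearMap.range T.moduleCatToCycles) (γ.φK x) :=
    congrArg (fun f => f.hom x) γ.commπ
  rw [γ.quasiIso_iff, ConcreteCategory.isIso_iff_bijective]
  constructor
  · rintro ⟨hi, hs⟩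
    constructor
    · intro x y hx hxy
      have h0 : Submodule.Quotient.mk (p := LinearMap.range S.moduleCatToCycles) ⟨x, hx⟩ = 0 := by
        refine hi ?_
        erw [hH, map_zero]
        refine (Submodule.Quotient.mk_eq_zero _).2 ⟨y, Subtype.ext ?_⟩
        rw [hK]
        exact hxy.symm
      obtain ⟨x', hx'⟩ := (Submodule.Quotient.mk_eq_zero _).1 h0
      exact ⟨x', congrArg Subtype.val hx'⟩
    · intro y hy
      obtain ⟨z, hz⟩ := hs (Submodule.Quotient.mk (p := LinearMap.range T.moduleCatToCycles) ⟨y, hy⟩)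
      obtain ⟨x, rfl⟩ := Submodule.Quotient.mk_surjective _ z
      erw [hH] at hz
      obtain ⟨y', hy'⟩ := (Submodule.Quotient.eq _).1 hz.symm
      refine ⟨x.1, y', x.2, ?_⟩
      have e := congrArg Subtype.val hy'
      change T.f y' = y - (γ.φK x : LinearMap.ker T.g.hom).1 at e
      rw [hK] at e
      rw [e]
      abel
  · rintro ⟨hi, hs⟩
    constructor
    · refine (injective_iff_map_eq_zero γ.φH.hom).2 ?_
      intro z hz
      obtain ⟨x, rfl⟩ := Submodule.Quotient.mk_surjective _ z
      erw [hH] at hz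
      obtain ⟨y, hy⟩ := (Submodule.Quotient.mk_eq_zero _).1 hz
      have e := congrArg Subtype.val hy
      rw [hK] at e
      obtain ⟨x', hx'⟩ := hi x.1 y x.2 e.symm
      exact (Submodule.Quotient.mk_eq_zero _).2 ⟨x', Subtype.ext hx'⟩
    · intro z
      obtain ⟨y, rfl⟩ := Submodule.Quotient.mk_surjective _ z
      obtain ⟨x, y', hx, e⟩ := hs y.1 y.2
      refine ⟨Submodule.Quotient.mk (p := LinearMap.range S.moduleCatToCycles) ⟨x, hx⟩, ?_⟩
      erw [hH]
      refine ((Submodule.Quotient.eq (LinearMap.range T.moduleCatToCycles)).2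
        ⟨y', Subtype.ext ?_⟩).symm
      change T.f y' = y.1 - (γ.φK ⟨x, hx⟩ : LinearMap.ker T.g.hom).1
      rw [hK, ← e]
      abel

namespace CochainComplex

variable {K : Type u} [Field K] {A B C : CochainComplex (ModuleCat.{u} K) ℤ}

theorem d_d_apply (A : CochainComplex (ModuleCat.{u} K) ℤ) (i j k : ℤ) (x : A.X i) :
    A.d j k (A.d i j x) = 0 := by
  rw [← ModuleCat.comp_apply, A.d_comp_d]
  rfl

theorem hom_d_apply (f : A ⟶ B) (i j : ℤ) (x : A.X i) :
    f.f j (A.d i j x) = B.d i j (f.f i x) :=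
  (ConcreteCategory.congr_hom (f.comm i j) x).symm

/-- This is acyclicity of the mapping cone. It merges injectivity on cohomology in degree `k`
(forget `y'`) with surjectivity in degree `j` (take `x = 0`), so that later proofs solve a single
lifting problem. -/
theorem quasiIso_iff_forall_exists (f : A ⟶ B) :
    QuasiIso f ↔ ∀ (i j k : ℤ), i + 1 = j → j + 1 = k → ∀ (x : A.X k) (y : B.X j),
      (∀ l, A.d k l x = 0) → f.f k x = B.d j k y →
        ∃ (x' : A.X j) (y' : B.X i), A.d j k x' = x ∧ f.f j x' + B.d i j y' = y := by
  have H (i j k : ℤ) (hij : i + 1 = j) (hjk : j + 1 = k) : QuasiIsoAt f j ↔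
      (∀ (x : A.X j) (y : B.X i), A.d j k x = 0 → f.f j x = B.d i j y →
        ∃ x' : A.X i, A.d i j x' = x) ∧
      (∀ y : B.X j, B.d j k y = 0 →
        ∃ (x : A.X j) (y' : B.X i), A.d j k x = 0 ∧ f.f j x + B.d i j y' = y) :=
    (quasiIsoAt_iff' f i j k (by simp; omega) (by simp; omega)).trans
      (ShortComplex.moduleCat_quasiIso_iff _)
  rw [quasiIso_iff]
  constructor
  · intro hf i j k hij hjk x y hx hxy
    obtain ⟨x', hx'⟩ := ((H j k (k + 1) hjk rfl).1 (hf k)).1 x y (hx _) hxy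
    -- The primitive `x'` need not match `y`, but `y - f x'` is a cocycle. Surjectivity on
    -- cohomology corrects `x'` by a cocycle `x₂`.
    obtain ⟨x₂, y', hx₂, e⟩ := ((H i j k hij hjk).1 (hf j)).2 (y - f.f j x') (by
      rw [map_sub, ← hom_d_apply, hx', hxy, sub_self])
    refine ⟨x' + x₂, y', by rw [map_add, hx', hx₂, add_zero], ?_⟩
    rw [map_add, add_assoc, e]
    abel
  · intro h k
    refine (H (k - 1) k (k + 1) (by omega) rfl).2 ⟨?_, ?_⟩
    · intro x y hx hxy
      obtain ⟨x', y', e, -⟩ := h (k - 1 - 1) (k - 1) k (by omega) (by omega) x y (by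
        intro l
        by_cases hl : k + 1 = l
        · subst hl; exact hx
        · rw [A.shape _ _ hl]; rfl) hxy
      exact ⟨x', e⟩
    · intro y hy
      obtain ⟨x', y', e, e'⟩ := h (k - 1) k (k + 1) (by omega) rfl 0 y (by simp) (by
        rw [map_zero]; exact hy.symm)
      exact ⟨x', y', e, e'⟩

end CochainComplex

/-! ### Polynomial extension of a DG-Lie algebra -/

noncomputable section

namespace DGLA

variable {K : Type u} [Field K]

section Polynomial

open Polynomial TensorProduct

/-- The `K[t]`-bilinear extension of the bracket of `N` to `K[t] ⊗ N`. -/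
def polyBracket (N : DGLA K) (i j k : ℤ) (h : i + j = k) :
    (K[X] ⊗[K] N.cx.X i) →ₗ[K] (K[X] ⊗[K] N.cx.X j) →ₗ[K] (K[X] ⊗[K] N.cx.X k) :=
  TensorProduct.map₂ (LinearMap.mul K K[X]) (N.bracket i j k h)

theorem polyBracket_tmul (N : DGLA K) (i j k : ℤ) (h : i + j = k) (p q : K[X])
    (x : N.cx.X i) (y : N.cx.X j) :
    polyBracket N i j k h (p ⊗ₜ x) (q ⊗ₜ y) = (p * q) ⊗ₜ N.bracket i j k h x y := rfl

theorem tmul_intUnits_smul {M : Type u} [AddCommGroup M] [Module K M] (p : K[X]) (u : ℤˣ)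
    (x : M) : p ⊗ₜ[K] (u • x) = u • p ⊗ₜ[K] x := by
  rcases Int.units_eq_one_or u with e | e <;> rw [e] <;> simp [TensorProduct.tmul_neg]

theorem polyBracket_skew (N : DGLA K) (i j k : ℤ) (h : i + j = k) (h' : j + i = k)
    (x : K[X] ⊗[K] N.cx.X i) (y : K[X] ⊗[K] N.cx.X j) :
    polyBracket N i j k h x y = -((i * j).negOnePow • polyBracket N j i k h' y x) := by
  induction x with
  | zero => rw [map_zero, map_zero, LinearMap.zero_apply, smul_zero, neg_zero]
  | add x x' hx hx' =>
    rw [map_add, LinearMap.add_apply, hx, hx', map_add, smul_add, neg_add]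
  | tmul p x =>
    induction y with
    | zero => rw [map_zero, map_zero, LinearMap.zero_apply, smul_zero, neg_zero]
    | add y y' hy hy' =>
      rw [map_add, hy, hy', map_add, LinearMap.add_apply, smul_add, neg_add]
    | tmul q y =>
      rw [polyBracket_tmul, polyBracket_tmul, N.skew i j k h h' x y, mul_comm p q,
        TensorProduct.tmul_neg, tmul_intUnits_smul]

theorem polyBracket_jacobi (N : DGLA K) (i j l ij jl il n : ℤ) (hij : i + j = ij)
    (hjl : j + l = jl) (hil : i + l = il) (h₁ : i + jl = n) (h₂ : ij + l = n) (h₃ : j + il = n)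
    (x : K[X] ⊗[K] N.cx.X i) (y : K[X] ⊗[K] N.cx.X j) (z : K[X] ⊗[K] N.cx.X l) :
    polyBracket N i jl n h₁ x (polyBracket N j l jl hjl y z) =
      polyBracket N ij l n h₂ (polyBracket N i j ij hij x y) z +
        (i * j).negOnePow • polyBracket N j il n h₃ y (polyBracket N i l il hil x z) := by
  induction x with
  | zero => simp only [map_zero, LinearMap.zero_apply, smul_zero, add_zero]
  | add x x' hx hx' =>
    simp only [map_add, LinearMap.add_apply, hx, hx', smul_add]
    abel
  | tmul p x =>
    induction y with
    | zero => simp only [map_zero, LinearMap.zero_apply, smul_zero, add_zero]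
    | add y y' hy hy' =>
      simp only [map_add, LinearMap.add_apply, hy, hy', smul_add]
      abel
    | tmul q y =>
      induction z with
      | zero => simp only [map_zero, smul_zero, add_zero]
      | add z z' hz hz' =>
        simp only [map_add, hz, hz', smul_add]
        abel
      | tmul r z =>
        simp only [polyBracket_tmul]
        rw [N.jacobi i j l ij jl il n hij hjl hil h₁ h₂ h₃ x y z, TensorProduct.tmul_add,
          mul_assoc, mul_left_comm q p r, tmul_intUnits_smul]

theorem polyBracket_leibniz (N : DGLA K) (i j k i' j' k' : ℤ) (h : i + j = k) (hi : i + 1 = i')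
    (hj : j + 1 = j') (hk : k + 1 = k') (h₁ : i' + j = k') (h₂ : i + j' = k')
    (x : K[X] ⊗[K] N.cx.X i) (y : K[X] ⊗[K] N.cx.X j) :
    (N.cx.d k k').hom.lTensor K[X] (polyBracket N i j k h x y) =
      polyBracket N i' j k' h₁ ((N.cx.d i i').hom.lTensor K[X] x) y +
        i.negOnePow • polyBracket N i j' k' h₂ x ((N.cx.d j j').hom.lTensor K[X] y) := by
  induction x with
  | zero => simp only [map_zero, LinearMap.zero_apply, smul_zero, add_zero]
  | add x x' hx hx' =>
    simp only [map_add, LinearMap.add_apply, hx, hx', smul_add]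
    abel
  | tmul p x =>
    induction y with
    | zero => simp only [map_zero, smul_zero, add_zero]
    | add y y' hy hy' =>
      simp only [map_add, hy, hy', smul_add]
      abel
    | tmul q y =>
      simp only [polyBracket_tmul, LinearMap.lTensor_tmul]
      rw [N.leibniz i j k i' j' k' h hi hj hk h₁ h₂ x y, TensorProduct.tmul_add,
        tmul_intUnits_smul]

/-- `K[t] ⊗ N`, with the `K[t]`-bilinear extensions of the differential and the bracket of `N`. -/
def polynomial (N : DGLA K) : DGLA K where
  cx :=
    { X := fun i => ModuleCat.of K (K[X] ⊗[K] N.cx.X i)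
      d := fun i j => ModuleCat.ofHom ((N.cx.d i j).hom.lTensor K[X])
      shape := fun i j h => by
        rw [N.cx.shape i j h, ModuleCat.hom_zero, LinearMap.lTensor_zero]
        rfl
      d_comp_d' := fun i j k _ _ => by
        rw [← ModuleCat.ofHom_comp, ← LinearMap.lTensor_comp, ← ModuleCat.hom_comp,
          N.cx.d_comp_d, ModuleCat.hom_zero, LinearMap.lTensor_zero]
        rfl }
  bracket := polyBracket N
  skew := polyBracket_skew N
  jacobi := polyBracket_jacobi N
  leibniz := polyBracket_leibniz N

end Polynomial

/-! ### Adjoining `dt` along a derivation -/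

/-- A derivation of degree `0` that commutes with the differential. -/
structure Derivation (A : DGLA K) where
  /-- the component of degree `i` -/
  map (i : ℤ) : A.cx.X i →ₗ[K] A.cx.X i
  map_d (i j : ℤ) (x : A.cx.X i) : map j (A.cx.d i j x) = A.cx.d i j (map i x)
  map_bracket (i j k : ℤ) (h : i + j = k) (x : A.cx.X i) (y : A.cx.X j) :
    map k (A.bracket i j k h x y) = A.bracket i j k h (map i x) y + A.bracket i j k h x (map j y)

/-- Transport along an equality of degrees. -/
def tr (A : CochainComplex (ModuleCat.{u} K) ℤ) {i j : ℤ} (h : i = j) : A.X i →ₗ[K] A.X j :=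
  h ▸ LinearMap.id

@[simp]
theorem tr_rfl (A : CochainComplex (ModuleCat.{u} K) ℤ) {i : ℤ} (x : A.X i) :
    tr A rfl x = x := rfl

theorem d_tr (A : CochainComplex (ModuleCat.{u} K) ℤ) {i j k : ℤ} (h : i = j) (x : A.X i) :
    A.d j k (tr A h x) = A.d i k x := by
  subst h; rfl

theorem tr_d (A : CochainComplex (ModuleCat.{u} K) ℤ) {i j k : ℤ} (h : j = k) (x : A.X i) :
    tr A h (A.d i j x) = A.d i k x := by
  subst h; rfl

theorem hom_tr {A B : CochainComplex (ModuleCat.{u} K) ℤ} (f : A ⟶ B) {i j : ℤ} (h : i = j)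
    (x : A.X i) : f.f j (tr A h x) = tr B h (f.f i x) := by
  subst h; rfl

theorem bracket_tr_left (A : DGLA K) {i i' j k : ℤ} (e : i = i') (h : i' + j = k)
    (x : A.cx.X i) (y : A.cx.X j) :
    A.bracket i' j k h (tr A.cx e x) y = A.bracket i j k (by omega) x y := by
  subst e; rfl

theorem bracket_tr_right (A : DGLA K) {i j j' k : ℤ} (e : j = j') (h : i + j' = k)
    (x : A.cx.X i) (y : A.cx.X j) :
    A.bracket i j' k h x (tr A.cx e y) = A.bracket i j k (by omega) x y := by
  subst e; rfl

theorem tr_bracket (A : DGLA K) {i j k k' : ℤ} (e : k = k') (h : i + j = k)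
    (x : A.cx.X i) (y : A.cx.X j) :
    tr A.cx e (A.bracket i j k h x y) = A.bracket i j k' (by omega) x y := by
  subst e; rfl

/-- The differential of `A ⊕ dt A`. -/
def adjoinDtD (A : DGLA K) (D : A.Derivation) (i j : ℤ) :
    (A.cx.X i × A.cx.X (i - 1)) →ₗ[K] (A.cx.X j × A.cx.X (j - 1)) :=
  ((A.cx.d i j).hom.comp (LinearMap.fst K _ _)).prod
    -- The coefficient of `dt` in degree `j` lives in degree `j - 1`, which is `i` only up to
    -- transport. The minus sign comes from moving the differential past `dt`, which has degree 1.
    ((if h : i + 1 = j then (tr A.cx (by omega)).comp ((D.map i).comp (LinearMap.fst K _ _))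
      else 0) - (A.cx.d (i - 1) (j - 1)).hom.comp (LinearMap.snd K _ _))

theorem adjoinDtD_fst (A : DGLA K) (D : A.Derivation) (i j : ℤ)
    (x : A.cx.X i × A.cx.X (i - 1)) : (adjoinDtD A D i j x).1 = A.cx.d i j x.1 := rfl

theorem adjoinDtD_snd (A : DGLA K) (D : A.Derivation) (i j : ℤ) (h : i + 1 = j)
    (x : A.cx.X i × A.cx.X (i - 1)) :
    (adjoinDtD A D i j x).2 =
      tr A.cx (by omega) (D.map i x.1) - A.cx.d (i - 1) (j - 1) x.2 := by
  subst h
  simp [adjoinDtD]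

/-- For a DG-Lie algebra `A` with a derivation `D`, the DG-Lie algebra `A ⊕ dt A` with
differential `d (a + dt α) = d a + dt (D a - d α)`. -/
def adjoinDt (A : DGLA K) (D : A.Derivation) : DGLA K where
  cx :=
    { X := fun i => ModuleCat.of K (A.cx.X i × A.cx.X (i - 1))
      d := fun i j => ModuleCat.ofHom (adjoinDtD A D i j)
      shape := fun i j h => by
        have h' : ¬ i + 1 = j := h
        have h'' : ¬ (ComplexShape.up ℤ).Rel (i - 1) (j - 1) := by
          simp only [ComplexShape.up_Rel]; omega
        refine ModuleCat.hom_ext (LinearMap.ext fun x => ?_)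
        change adjoinDtD A D i j x = 0
        simp [adjoinDtD, h', A.cx.shape _ _ h'']
      d_comp_d' := fun i j k hij hjk => by
        refine ModuleCat.hom_ext (LinearMap.ext fun x => ?_)
        change adjoinDtD A D j k (adjoinDtD A D i j x) = 0
        refine Prod.ext ?_ ?_
        · rw [adjoinDtD_fst, adjoinDtD_fst, d_d_apply]
          rfl
        · rw [adjoinDtD_snd A D j k hjk, adjoinDtD_snd A D i j hij, adjoinDtD_fst, map_sub,
            d_d_apply, d_tr, D.map_d, tr_d]
          simp }
  bracket i j k h := LinearMap.mk₂ K
    (fun (x : A.cx.X i × A.cx.X (i - 1)) (y : A.cx.X j × A.cx.X (j - 1)) =>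
      ((A.bracket i j k h x.1 y.1,
        -- The sign on the second summand comes from moving `dt` to the left past an element of
        -- degree `i`. There is no term in `x.2` and `y.2` because `dt · dt = 0`.
        A.bracket (i - 1) j (k - 1) (by omega) x.2 y.1 +
          i.negOnePow • A.bracket i (j - 1) (k - 1) (by omega) x.1 y.2) :
        A.cx.X k × A.cx.X (k - 1)))
    (fun x x' y => by
      refine Prod.ext ?_ ?_
      · simp
      · simp only [Prod.fst_add, Prod.snd_add, map_add, LinearMap.add_apply, smul_add]
        abel)
    (fun c x y => by
      refine Prod.ext ?_ ?_
      · simp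
      · simp only [Prod.smul_fst, Prod.smul_snd, map_smul, LinearMap.smul_apply, smul_add]
        rw [smul_comm c])
    (fun x y y' => by
      refine Prod.ext ?_ ?_
      · simp
      · simp only [Prod.fst_add, Prod.snd_add, map_add, smul_add]
        abel)
    (fun c x y => by
      refine Prod.ext ?_ ?_
      · simp
      · simp only [Prod.smul_fst, Prod.smul_snd, map_smul, smul_add]
        rw [smul_comm c])
  skew i j k h h' x y := by
    change A.cx.X i × A.cx.X (i - 1) at x
    change A.cx.X j × A.cx.X (j - 1) at y
    obtain ⟨a, α⟩ := x
    obtain ⟨b, β⟩ := y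
    refine Prod.ext (A.skew i j k h h' a b) ?_
    change A.bracket (i - 1) j (k - 1) _ α b + i.negOnePow • A.bracket i (j - 1) (k - 1) _ a β =
      -((i * j).negOnePow • (A.bracket (j - 1) i (k - 1) _ β a +
        j.negOnePow • A.bracket j (i - 1) (k - 1) _ b α))
    rw [A.skew (i - 1) j (k - 1) (by omega) (by omega) α b,
      A.skew i (j - 1) (k - 1) (by omega) (by omega) a β]
    simp only [sub_mul, mul_sub, one_mul, mul_one, Int.negOnePow_sub]
    -- All signs are products of the signs of `i * j`, `i` and `j`. Fixing these three leaves
    -- identities in an abelian group.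
    rcases Int.units_eq_one_or (i * j).negOnePow with e | e <;>
    rcases Int.units_eq_one_or i.negOnePow with e' | e' <;>
    rcases Int.units_eq_one_or j.negOnePow with e'' | e'' <;>
    · simp only [e, e', e'', Units.neg_smul, one_smul, mul_one, mul_neg, neg_neg]
      abel
  jacobi i j l ij jl il n hij hjl hil h₁ h₂ h₃ x y z := by
    change A.cx.X i × A.cx.X (i - 1) at x
    change A.cx.X j × A.cx.X (j - 1) at y
    change A.cx.X l × A.cx.X (l - 1) at z
    obtain ⟨a, α⟩ := x
    obtain ⟨b, β⟩ := y
    obtain ⟨c, γ⟩ := z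
    refine Prod.ext (A.jacobi i j l ij jl il n hij hjl hil h₁ h₂ h₃ a b c) ?_
    change A.bracket (i - 1) jl (n - 1) _ α (A.bracket j l jl hjl b c) +
        i.negOnePow • A.bracket i (jl - 1) (n - 1) _ a (A.bracket (j - 1) l (jl - 1) _ β c +
          j.negOnePow • A.bracket j (l - 1) (jl - 1) _ b γ) =
      (A.bracket (ij - 1) l (n - 1) _ (A.bracket (i - 1) j (ij - 1) _ α b +
          i.negOnePow • A.bracket i (j - 1) (ij - 1) _ a β) c +
        ij.negOnePow • A.bracket ij (l - 1) (n - 1) _ (A.bracket i j ij hij a b) γ) +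
      (i * j).negOnePow • (A.bracket (j - 1) il (n - 1) _ β (A.bracket i l il hil a c) +
        j.negOnePow • A.bracket j (il - 1) (n - 1) _ b (A.bracket (i - 1) l (il - 1) _ α c +
          i.negOnePow • A.bracket i (l - 1) (il - 1) _ a γ))
    have s (m m' : ℤ) (u : ℤˣ) (f : A.cx.X m →ₗ[K] A.cx.X m') (x : A.cx.X m) :
        f (u • x) = u • f x := by
      rcases Int.units_eq_one_or u with e | e <;> simp [e]
    have s' (m m' m'' : ℤ) (u : ℤˣ) (f : A.cx.X m →ₗ[K] A.cx.X m' →ₗ[K] A.cx.X m'')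
        (x : A.cx.X m) (y : A.cx.X m') : f (u • x) y = u • f x y := by
      rcases Int.units_eq_one_or u with e | e <;> simp [e]
    simp only [map_add, LinearMap.add_apply, s, s']
    rw [A.jacobi (i - 1) j l (ij - 1) jl (il - 1) (n - 1) (by omega) (by omega) (by omega)
        (by omega) (by omega) (by omega) α b c,
      A.jacobi i (j - 1) l (ij - 1) (jl - 1) il (n - 1) (by omega) (by omega) (by omega)
        (by omega) (by omega) (by omega) a β c,
      A.jacobi i j (l - 1) ij (jl - 1) (il - 1) (n - 1) (by omega) (by omega) (by omega)
        (by omega) (by omega) (by omega) a b γ]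
    simp only [← hij, sub_mul, mul_sub, one_mul, mul_one, Int.negOnePow_sub, Int.negOnePow_add]
    rcases Int.units_eq_one_or (i * j).negOnePow with e | e <;>
    rcases Int.units_eq_one_or i.negOnePow with e' | e' <;>
    rcases Int.units_eq_one_or j.negOnePow with e'' | e'' <;>
    · simp only [e, e', e'', Units.neg_smul, one_smul, mul_one, mul_neg, neg_neg]
      abel
  leibniz i j k i' j' k' h hi hj hk h₁ h₂ x y := by
    change A.cx.X i × A.cx.X (i - 1) at x
    change A.cx.X j × A.cx.X (j - 1) at y
    obtain ⟨a, α⟩ := x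
    obtain ⟨b, β⟩ := y
    refine Prod.ext (A.leibniz i j k i' j' k' h hi hj hk h₁ h₂ a b) ?_
    change (adjoinDtD A D k k' (A.bracket i j k h a b, A.bracket (i - 1) j (k - 1) _ α b +
        i.negOnePow • A.bracket i (j - 1) (k - 1) _ a β)).2 =
      (A.bracket (i' - 1) j (k' - 1) _ (adjoinDtD A D i i' (a, α)).2 b +
        i'.negOnePow • A.bracket i' (j - 1) (k' - 1) _ (A.cx.d i i' a) β) +
      i.negOnePow • (A.bracket (i - 1) j' (k' - 1) _ α (A.cx.d j j' b) +
        i.negOnePow • A.bracket i (j' - 1) (k' - 1) _ a (adjoinDtD A D j j' (b, β)).2)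
    rw [adjoinDtD_snd _ _ _ _ hk, adjoinDtD_snd _ _ _ _ hi, adjoinDtD_snd _ _ _ _ hj]
    have s (m m' : ℤ) (u : ℤˣ) (x : A.cx.X m) :
        A.cx.d m m' (u • x) = u • A.cx.d m m' x := by
      rcases Int.units_eq_one_or u with e | e <;> simp [e]
    simp only [map_add, map_sub, LinearMap.sub_apply, s, bracket_tr_left, bracket_tr_right,
      D.map_bracket, tr_bracket]
    rw [A.leibniz (i - 1) j (k - 1) (i' - 1) j' (k' - 1) (by omega) (by omega) hj (by omega)
        (by omega) (by omega) α b,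
      A.leibniz i (j - 1) (k - 1) i' (j' - 1) (k' - 1) (by omega) hi (by omega) (by omega)
        (by omega) (by omega) a β]
    simp only [← hi, Int.negOnePow_sub, Int.negOnePow_add, Int.negOnePow_one]
    rcases Int.units_eq_one_or i.negOnePow with e' | e' <;>
    · simp only [e', Units.neg_smul, one_smul, mul_one, mul_neg, neg_neg]
      abel

section AdjoinDt

variable (A : DGLA K) (D : A.Derivation)

/-- The projection `a + dt α ↦ a`. -/
def dtFst : Hom (A.adjoinDt D) A where
  toHom :=
    { f := fun i => ModuleCat.ofHom (LinearMap.fst K (A.cx.X i) (A.cx.X (i - 1)))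
      comm' := fun _ _ _ => rfl }
  map_bracket _ _ _ _ _ _ := rfl

/-- The coefficient `α` of `a + dt α`. -/
def dtSnd (i : ℤ) : (A.adjoinDt D).cx.X i →ₗ[K] A.cx.X (i - 1) :=
  LinearMap.snd K (A.cx.X i) (A.cx.X (i - 1))

/-- The inclusion `a ↦ a`. -/
def dtInl (i : ℤ) : A.cx.X i →ₗ[K] (A.adjoinDt D).cx.X i :=
  LinearMap.inl K (A.cx.X i) (A.cx.X (i - 1))

/-- The map `α ↦ dt α`. -/
def dtInr (i : ℤ) : A.cx.X (i - 1) →ₗ[K] (A.adjoinDt D).cx.X i :=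
  LinearMap.inr K (A.cx.X i) (A.cx.X (i - 1))

variable {A D} in
theorem dt_ext {i : ℤ} {x y : (A.adjoinDt D).cx.X i}
    (h₁ : (A.dtFst D).toHom.f i x = (A.dtFst D).toHom.f i y)
    (h₂ : A.dtSnd D i x = A.dtSnd D i y) : x = y :=
  Prod.ext h₁ h₂

@[simp]
theorem dtFst_dtInl (i : ℤ) (x : A.cx.X i) : (A.dtFst D).toHom.f i (A.dtInl D i x) = x := rfl

@[simp]
theorem dtSnd_dtInl (i : ℤ) (x : A.cx.X i) : A.dtSnd D i (A.dtInl D i x) = 0 := rfl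

@[simp]
theorem dtFst_dtInr (i : ℤ) (x : A.cx.X (i - 1)) :
    (A.dtFst D).toHom.f i (A.dtInr D i x) = 0 := rfl

@[simp]
theorem dtSnd_dtInr (i : ℤ) (x : A.cx.X (i - 1)) : A.dtSnd D i (A.dtInr D i x) = x := rfl

theorem dtSnd_d (i j : ℤ) (h : i + 1 = j) (x : (A.adjoinDt D).cx.X i) :
    A.dtSnd D j ((A.adjoinDt D).cx.d i j x) =
      tr A.cx (by omega) (D.map i ((A.dtFst D).toHom.f i x)) -
        A.cx.d (i - 1) (j - 1) (A.dtSnd D i x) :=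
  adjoinDtD_snd A D i j h x

theorem dtSnd_bracket (i j k : ℤ) (h : i + j = k) (x : (A.adjoinDt D).cx.X i)
    (y : (A.adjoinDt D).cx.X j) :
    A.dtSnd D k ((A.adjoinDt D).bracket i j k h x y) =
      A.bracket (i - 1) j (k - 1) (by omega) (A.dtSnd D i x) ((A.dtFst D).toHom.f j y) +
        i.negOnePow • A.bracket i (j - 1) (k - 1) (by omega) ((A.dtFst D).toHom.f i x)
          (A.dtSnd D j y) := rfl

theorem d_dtInl (i j : ℤ) (h : i = j - 1) (x : A.cx.X i) :
    (A.adjoinDt D).cx.d i j (A.dtInl D i x) =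
      A.dtInl D j (A.cx.d i j x) + A.dtInr D j (tr A.cx h (D.map i x)) := by
  refine dt_ext ?_ ?_
  · rw [hom_d_apply, map_add, dtFst_dtInl, dtFst_dtInl, dtFst_dtInr, add_zero]
  · rw [dtSnd_d A D i j (by omega), map_add, dtFst_dtInl, dtSnd_dtInl, dtSnd_dtInl, dtSnd_dtInr,
      map_zero, sub_zero, zero_add]

theorem d_dtInr (i j : ℤ) (h : i + 1 = j) (x : A.cx.X (i - 1)) :
    (A.adjoinDt D).cx.d i j (A.dtInr D i x) = -A.dtInr D j (A.cx.d (i - 1) (j - 1) x) := by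
  refine dt_ext ?_ ?_
  · rw [hom_d_apply, map_neg, dtFst_dtInr, dtFst_dtInr, map_zero, neg_zero]
  · rw [dtSnd_d A D i j h, map_neg, dtFst_dtInr, dtSnd_dtInr, dtSnd_dtInr,
      map_zero, map_zero, zero_sub]

/-- This is `dt · dt = 0`. All vanishing of brackets in the final answer comes from here. -/
theorem bracket_dtInr (i j k : ℤ) (h : i + j = k) (x : A.cx.X (i - 1)) (y : A.cx.X (j - 1)) :
    (A.adjoinDt D).bracket i j k h (A.dtInr D i x) (A.dtInr D j y) = 0 := by
  refine dt_ext ?_ ?_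
  · rw [(A.dtFst D).map_bracket, dtFst_dtInr, map_zero, map_zero, LinearMap.zero_apply]
  · rw [dtSnd_bracket, dtFst_dtInr, dtFst_dtInr, map_zero, map_zero, map_zero,
      LinearMap.zero_apply, smul_zero, add_zero]

/-- A morphism into the kernel of `D`, as a morphism into `A ⊕ dt A`. -/
def dtLift {N : DGLA K} (g : Hom N A) (hg : ∀ i x, D.map i (g.toHom.f i x) = 0) :
    Hom N (A.adjoinDt D) where
  toHom :=
    { f := fun i => ModuleCat.ofHom (A.dtInl D i ∘ₗ (g.toHom.f i).hom)
      comm' := fun i j h => by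
        have h' : i + 1 = j := h
        refine ModuleCat.hom_ext (LinearMap.ext fun x => ?_)
        change (A.adjoinDt D).cx.d i j (A.dtInl D i (g.toHom.f i x)) =
          A.dtInl D j (g.toHom.f j (N.cx.d i j x))
        rw [d_dtInl A D i j (by omega), hg, map_zero, map_zero, add_zero, hom_d_apply] }
  map_bracket i j k h x y := by
    change A.dtInl D k (g.toHom.f k (N.bracket i j k h x y)) = (A.adjoinDt D).bracket i j k h
      (A.dtInl D i (g.toHom.f i x)) (A.dtInl D j (g.toHom.f j y))
    refine dt_ext ?_ ?_
    · rw [(A.dtFst D).map_bracket, dtFst_dtInl, dtFst_dtInl, dtFst_dtInl, g.map_bracket]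
    · rw [dtSnd_bracket, dtSnd_dtInl, dtSnd_dtInl, dtSnd_dtInl, map_zero, map_zero,
        LinearMap.zero_apply, smul_zero, add_zero]

variable {A D} {B : DGLA K} {E : B.Derivation} (f : Hom A B)
  (hf : ∀ i x, f.toHom.f i (D.map i x) = E.map i (f.toHom.f i x))

/-- The morphism `A ⊕ dt A → B ⊕ dt B` induced by a morphism that commutes with the
derivations, in degree `i`. -/
def dtMapLinear (D : A.Derivation) (E : B.Derivation) (i : ℤ) :
    (A.adjoinDt D).cx.X i →ₗ[K] (B.adjoinDt E).cx.X i :=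
  B.dtInl E i ∘ₗ (f.toHom.f i).hom ∘ₗ ((A.dtFst D).toHom.f i).hom +
    B.dtInr E i ∘ₗ (f.toHom.f (i - 1)).hom ∘ₗ A.dtSnd D i

theorem dtFst_dtMapLinear (i : ℤ) (x : (A.adjoinDt D).cx.X i) :
    (B.dtFst E).toHom.f i (dtMapLinear f D E i x) = f.toHom.f i ((A.dtFst D).toHom.f i x) := by
  simp [dtMapLinear]

theorem dtSnd_dtMapLinear (i : ℤ) (x : (A.adjoinDt D).cx.X i) :
    B.dtSnd E i (dtMapLinear f D E i x) = f.toHom.f (i - 1) (A.dtSnd D i x) := by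
  simp [dtMapLinear]

/-- The morphism `A ⊕ dt A → B ⊕ dt B` induced by a morphism that commutes with the
derivations. -/
def dtMap : Hom (A.adjoinDt D) (B.adjoinDt E) where
  toHom :=
    { f := fun i => ModuleCat.ofHom (dtMapLinear f D E i)
      comm' := fun i j h => by
        have h' : i + 1 = j := h
        refine ModuleCat.hom_ext (LinearMap.ext fun x => ?_)
        change (B.adjoinDt E).cx.d i j (dtMapLinear f D E i x) =
          dtMapLinear f D E j ((A.adjoinDt D).cx.d i j x)
        refine dt_ext ?_ ?_
        · rw [hom_d_apply, dtFst_dtMapLinear, dtFst_dtMapLinear, hom_d_apply, hom_d_apply]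
        · rw [dtSnd_d _ _ _ _ h', dtSnd_dtMapLinear, dtFst_dtMapLinear, dtSnd_dtMapLinear,
            dtSnd_d _ _ _ _ h', map_sub, hom_tr, hf, hom_d_apply] }
  map_bracket i j k h x y := by
    change dtMapLinear f D E k ((A.adjoinDt D).bracket i j k h x y) =
      (B.adjoinDt E).bracket i j k h (dtMapLinear f D E i x) (dtMapLinear f D E j y)
    refine dt_ext ?_ ?_
    · rw [(B.dtFst E).map_bracket, dtFst_dtMapLinear, dtFst_dtMapLinear, dtFst_dtMapLinear,
        (A.dtFst D).map_bracket, f.map_bracket]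
    · rw [dtSnd_bracket, dtSnd_dtMapLinear, dtSnd_bracket, dtFst_dtMapLinear, dtFst_dtMapLinear,
        dtSnd_dtMapLinear, dtSnd_dtMapLinear, map_add, f.map_bracket, ← f.map_bracket i]
      rcases Int.units_eq_one_or i.negOnePow with e | e <;> rw [e] <;> simp

theorem dtMap_dtInl (i : ℤ) (x : A.cx.X i) :
    (dtMap f hf).toHom.f i (A.dtInl D i x) = B.dtInl E i (f.toHom.f i x) := by
  refine (dt_ext ?_ ?_ : dtMapLinear f D E i _ = _)
  · rw [dtFst_dtMapLinear, dtFst_dtInl, dtFst_dtInl]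
  · rw [dtSnd_dtMapLinear, dtSnd_dtInl, dtSnd_dtInl, map_zero]

theorem dtMap_dtInr (i : ℤ) (x : A.cx.X (i - 1)) :
    (dtMap f hf).toHom.f i (A.dtInr D i x) = B.dtInr E i (f.toHom.f (i - 1) x) := by
  refine (dt_ext ?_ ?_ : dtMapLinear f D E i _ = _)
  · rw [dtFst_dtMapLinear, dtFst_dtInr, dtFst_dtInr, map_zero]
  · rw [dtSnd_dtMapLinear, dtSnd_dtInr, dtSnd_dtInr]

theorem dtFst_dtMap (i : ℤ) (x : (A.adjoinDt D).cx.X i) :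
    (B.dtFst E).toHom.f i ((dtMap f hf).toHom.f i x) =
      f.toHom.f i ((A.dtFst D).toHom.f i x) :=
  dtFst_dtMapLinear f i x

/-- Write `γ = a + dt α`. Closedness gives `D a = d α`, so `d (J α) = J (d α) + dt (D (J α)) = J (D
a) + dt α`, which is `γ` as soon as `J (D a) = a`. That last condition is a hypothesis on `γ`
because `J` is assumed to be only a right inverse of `D`; for integration it says that the constant
term of `a` vanishes. -/
theorem exists_dt_primitive (J : ∀ i, A.cx.X i →ₗ[K] A.cx.X i)
    (hJd : ∀ i j x, J j (A.cx.d i j x) = A.cx.d i j (J i x))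
    (hDJ : ∀ i x, D.map i (J i x) = x) (i j : ℤ) (h : i + 1 = j) (γ : (A.adjoinDt D).cx.X j)
    (hγ : ∀ k, (A.adjoinDt D).cx.d j k γ = 0)
    (hJD : J j (D.map j ((A.dtFst D).toHom.f j γ)) = (A.dtFst D).toHom.f j γ) :
    ∃ b : A.cx.X i, (A.adjoinDt D).cx.d i j (A.dtInl D i (J i b)) = γ := by
  have hJtr (i j : ℤ) (h : i = j) (x : A.cx.X i) : J j (tr A.cx h x) = tr A.cx h (J i x) := by
    subst h; rfl
  have htr (i j : ℤ) (h : i = j) : Function.Injective (tr A.cx h) := by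
    subst h; exact Function.injective_id
  obtain rfl : i = j - 1 := eq_sub_of_add_eq h
  -- The `dt`-component of `d γ = 0` reads `D a = d α`, up to a transport from degree `j` to degree
  -- `j + 1 - 1`.
  have hα := dtSnd_d A D j (j + 1) rfl γ
  rw [hγ, map_zero] at hα
  have hJ : tr A.cx (by omega : j = j + 1 - 1) (J j (D.map j ((A.dtFst D).toHom.f j γ))) =
      tr A.cx (by omega) (A.cx.d (j - 1) j (J (j - 1) (A.dtSnd D j γ))) := by
    rw [← hJtr, tr_d, ← hJd, sub_eq_zero.1 hα.symm]
  have hJ' := htr _ _ _ hJ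
  rw [hJD] at hJ'
  refine ⟨A.dtSnd D j γ, ?_⟩
  rw [d_dtInl A D (j - 1) j rfl, hDJ]
  refine dt_ext ?_ ?_
  · rw [map_add, dtFst_dtInl, dtFst_dtInr, add_zero, hJ']
  · rw [map_add, dtSnd_dtInl, dtSnd_dtInr, zero_add, tr_rfl]

end AdjoinDt

end DGLA

end

/-! ### Integration of polynomials and the path object `N[t, dt]` -/

noncomputable section

open Polynomial TensorProduct

/-- The antiderivative of a polynomial, with constant term `0`. -/
def Polynomial.antiderivative (K : Type u) [Field K] : K[X] →ₗ[K] K[X] :=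
  Polynomial.lsum fun n => (n + 1 : K)⁻¹ • monomial (n + 1)

namespace Polynomial

variable {K : Type u} [Field K]

theorem antiderivative_monomial (n : ℕ) (c : K) :
    antiderivative K (monomial n c) = monomial (n + 1) ((n + 1 : K)⁻¹ * c) := by
  simp [antiderivative, sum_monomial_index, smul_monomial]

/-- Characteristic 0 enters here: integrating a monomial divides by `n + 1`. -/
theorem derivative_comp_antiderivative [CharZero K] :
    (derivative : K[X] →ₗ[K] K[X]) ∘ₗ antiderivative K = LinearMap.id := by
  refine lhom_ext' fun n => LinearMap.ext fun c => ?_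
  have h : (n + 1 : K) ≠ 0 := by exact_mod_cast n.succ_ne_zero
  simp only [LinearMap.comp_apply, antiderivative_monomial, derivative_monomial]
  simp only [Nat.add_sub_cancel, Nat.cast_add, Nat.cast_one, LinearMap.id_apply]
  congr 1
  field_simp

/-- The fundamental theorem of calculus: integrating the derivative of `p` from 0 recovers `p -
p(0)`. The constant monomial is the case in which the two terms on the right cancel. -/
theorem antiderivative_comp_derivative [CharZero K] :
    antiderivative K ∘ₗ (derivative : K[X] →ₗ[K] K[X]) =
      LinearMap.id - (Algebra.linearMap K K[X]) ∘ₗ leval 0 := by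
  refine lhom_ext' fun n => LinearMap.ext fun c => ?_
  simp only [LinearMap.comp_apply, derivative_monomial, antiderivative_monomial]
  rcases n with _ | n
  · simp [leval]
  · have h : (n + 1 : K) ≠ 0 := by exact_mod_cast n.succ_ne_zero
    simp only [Nat.add_sub_cancel, Nat.cast_add, Nat.cast_one, LinearMap.sub_apply,
      LinearMap.id_apply, LinearMap.comp_apply, leval_apply, eval_monomial]
    rw [zero_pow n.succ_ne_zero, mul_zero, map_zero, sub_zero]
    congr 1
    field_simp

theorem leval_comp_antiderivative : leval 0 ∘ₗ antiderivative K = 0 := by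
  refine lhom_ext' fun n => LinearMap.ext fun c => ?_
  simp [antiderivative_monomial]

end Polynomial

namespace DGLA

variable {K : Type u} [Field K]

/-- The two maps act on different tensor factors. Consequently `d/dt` and integration commute with
the differential of `N`, and `d/dt` commutes with the maps induced by morphisms. -/
theorem rTensor_lTensor_comm {M N : Type u} [AddCommGroup M] [Module K M] [AddCommGroup N]
    [Module K N] (f : K[X] →ₗ[K] K[X]) (g : M →ₗ[K] N) (x : K[X] ⊗[K] M) :
    f.rTensor N (g.lTensor K[X] x) = g.lTensor K[X] (f.rTensor M x) := by
  rw [← LinearMap.comp_apply, ← LinearMap.comp_apply, LinearMap.rTensor_comp_lTensor,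
    LinearMap.lTensor_comp_rTensor]

theorem rTensor_derivative_polyBracket (N : DGLA K) (i j k : ℤ) (h : i + j = k)
    (x : K[X] ⊗[K] N.cx.X i) (y : K[X] ⊗[K] N.cx.X j) :
    (derivative : K[X] →ₗ[K] K[X]).rTensor _ (polyBracket N i j k h x y) =
      polyBracket N i j k h ((derivative : K[X] →ₗ[K] K[X]).rTensor _ x) y +
        polyBracket N i j k h x ((derivative : K[X] →ₗ[K] K[X]).rTensor _ y) := by
  induction x with
  | zero => simp only [map_zero, LinearMap.zero_apply, add_zero]
  | add x x' hx hx' =>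
    simp only [map_add, LinearMap.add_apply, hx, hx']
    abel
  | tmul p x =>
    induction y with
    | zero => simp only [map_zero, add_zero]
    | add y y' hy hy' =>
      simp only [map_add, hy, hy']
      abel
    | tmul q y =>
      simp only [polyBracket_tmul, LinearMap.rTensor_tmul, derivative_mul, TensorProduct.add_tmul]

/-- The derivation `d/dt` of `K[t] ⊗ N`. -/
def polyDerivation (N : DGLA K) : N.polynomial.Derivation where
  map i := (derivative : K[X] →ₗ[K] K[X]).rTensor (N.cx.X i)
  map_d i j x := rTensor_lTensor_comm _ (N.cx.d i j).hom x
  map_bracket := rTensor_derivative_polyBracket N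

/-- Evaluation `K[t] ⊗ N → N` at `c`, in degree `i`. -/
def polyEval (N : DGLA K) (c : K) (i : ℤ) : (K[X] ⊗[K] N.cx.X i) →ₗ[K] N.cx.X i :=
  (TensorProduct.lid K (N.cx.X i)).toLinearMap ∘ₗ (leval c).rTensor (N.cx.X i)

@[simp]
theorem polyEval_tmul (N : DGLA K) (c : K) (i : ℤ) (p : K[X]) (x : N.cx.X i) :
    polyEval N c i (p ⊗ₜ x) = p.eval c • x := by
  simp [polyEval]

theorem polyEval_d (N : DGLA K) (c : K) (i j : ℤ) (x : K[X] ⊗[K] N.cx.X i) :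
    polyEval N c j ((N.cx.d i j).hom.lTensor K[X] x) = N.cx.d i j (polyEval N c i x) := by
  induction x with
  | zero => simp only [map_zero]
  | add x y hx hy => simp only [map_add, hx, hy]
  | tmul p x => rw [LinearMap.lTensor_tmul, polyEval_tmul, polyEval_tmul, map_smul]

theorem polyEval_bracket (N : DGLA K) (c : K) (i j k : ℤ) (h : i + j = k)
    (x : K[X] ⊗[K] N.cx.X i) (y : K[X] ⊗[K] N.cx.X j) :
    polyEval N c k (polyBracket N i j k h x y) =
      N.bracket i j k h (polyEval N c i x) (polyEval N c j y) := by
  induction x with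
  | zero => simp only [map_zero, LinearMap.zero_apply]
  | add x x' hx hx' => simp only [map_add, LinearMap.add_apply, hx, hx']
  | tmul p x =>
    induction y with
    | zero => simp only [map_zero]
    | add y y' hy hy' => simp only [map_add, hy, hy']
    | tmul q y =>
      simp only [polyBracket_tmul, polyEval_tmul, eval_mul, map_smul, LinearMap.smul_apply,
        smul_smul]
      rw [mul_comm]

/-- Evaluation `K[t] ⊗ N → N` at `c`. -/
def polyEvalHom (N : DGLA K) (c : K) : Hom N.polynomial N where
  toHom :=
    { f := fun i => ModuleCat.ofHom (polyEval N c i)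
      comm' := fun i j _ =>
        ModuleCat.hom_ext (LinearMap.ext fun x => (polyEval_d N c i j x).symm) }
  map_bracket := polyEval_bracket N c

/-- The inclusion `x ↦ p ⊗ x`. -/
def polyMul (N : DGLA K) (p : K[X]) (i : ℤ) : N.cx.X i →ₗ[K] N.polynomial.cx.X i :=
  TensorProduct.mk K K[X] (N.cx.X i) p

theorem polyMul_d (N : DGLA K) (p : K[X]) (i j : ℤ) (x : N.cx.X i) :
    N.polynomial.cx.d i j (polyMul N p i x) = polyMul N p j (N.cx.d i j x) := rfl

theorem polyEvalHom_polyMul (N : DGLA K) (c : K) (p : K[X]) (i : ℤ) (x : N.cx.X i) :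
    (polyEvalHom N c).toHom.f i (polyMul N p i x) = p.eval c • x :=
  polyEval_tmul N c i p x

theorem polyDerivation_polyMul (N : DGLA K) (p : K[X]) (i : ℤ) (x : N.cx.X i) :
    N.polyDerivation.map i (polyMul N p i x) = polyMul N (derivative p) i x := rfl

theorem polyMul_zero (N : DGLA K) (i : ℤ) (x : N.cx.X i) : polyMul N 0 i x = 0 :=
  TensorProduct.zero_tmul _ _

/-- The inclusion `N → K[t] ⊗ N`. -/
def polyConst (N : DGLA K) : Hom N N.polynomial where
  toHom :=
    { f := fun i => ModuleCat.ofHom (polyMul N 1 i)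
      comm' := fun _ _ _ => rfl }
  map_bracket i j k h x y := by
    change (1 : K[X]) ⊗ₜ[K] _ = (1 * 1 : K[X]) ⊗ₜ[K] N.bracket i j k h x y
    rw [mul_one]

theorem polyConst_apply (N : DGLA K) (i : ℤ) (x : N.cx.X i) :
    (polyConst N).toHom.f i x = polyMul N 1 i x := rfl

theorem lTensor_polyBracket {N M : DGLA K} (f : Hom N M) (i j k : ℤ) (h : i + j = k)
    (x : K[X] ⊗[K] N.cx.X i) (y : K[X] ⊗[K] N.cx.X j) :
    (f.toHom.f k).hom.lTensor K[X] (polyBracket N i j k h x y) =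
      polyBracket M i j k h ((f.toHom.f i).hom.lTensor K[X] x)
        ((f.toHom.f j).hom.lTensor K[X] y) := by
  induction x with
  | zero => simp only [map_zero, LinearMap.zero_apply]
  | add x x' hx hx' => simp only [map_add, LinearMap.add_apply, hx, hx']
  | tmul p x =>
    induction y with
    | zero => simp only [map_zero]
    | add y y' hy hy' => simp only [map_add, hy, hy']
    | tmul q y =>
      simp only [polyBracket_tmul, LinearMap.lTensor_tmul]
      rw [f.map_bracket]

/-- The action of `N ↦ K[t] ⊗ N` on morphisms. -/
def polyMap {N M : DGLA K} (f : Hom N M) : Hom N.polynomial M.polynomial where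
  toHom :=
    { f := fun i => ModuleCat.ofHom ((f.toHom.f i).hom.lTensor K[X])
      comm' := fun i j _ => by
        refine ModuleCat.hom_ext ?_
        change (M.cx.d i j).hom.lTensor K[X] ∘ₗ (f.toHom.f i).hom.lTensor K[X] =
          (f.toHom.f j).hom.lTensor K[X] ∘ₗ (N.cx.d i j).hom.lTensor K[X]
        rw [← LinearMap.lTensor_comp, ← LinearMap.lTensor_comp, ← ModuleCat.hom_comp,
          ← ModuleCat.hom_comp, f.toHom.comm] }
  map_bracket := lTensor_polyBracket f

theorem polyMap_polyDerivation {N M : DGLA K} (f : Hom N M) (i : ℤ) (x : N.polynomial.cx.X i) :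
    (polyMap f).toHom.f i (N.polyDerivation.map i x) =
      M.polyDerivation.map i ((polyMap f).toHom.f i x) :=
  (rTensor_lTensor_comm _ (f.toHom.f i).hom x).symm

theorem polyEval_lTensor {N M : DGLA K} (f : Hom N M) (c : K) (i : ℤ) (x : K[X] ⊗[K] N.cx.X i) :
    polyEval M c i ((f.toHom.f i).hom.lTensor K[X] x) = f.toHom.f i (polyEval N c i x) := by
  induction x with
  | zero => simp only [map_zero]
  | add x y hx hy => simp only [map_add, hx, hy]
  | tmul p x => rw [LinearMap.lTensor_tmul, polyEval_tmul, polyEval_tmul, map_smul]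

theorem polyEvalHom_polyMap {N M : DGLA K} (f : Hom N M) (c : K) (i : ℤ)
    (x : N.polynomial.cx.X i) : (polyEvalHom M c).toHom.f i ((polyMap f).toHom.f i x) =
      f.toHom.f i ((polyEvalHom N c).toHom.f i x) :=
  polyEval_lTensor f c i x

/-- Antiderivatives in `K[t] ⊗ N`. -/
def polyAntiderivative (N : DGLA K) (i : ℤ) : N.polynomial.cx.X i →ₗ[K] N.polynomial.cx.X i :=
  (antiderivative K).rTensor (N.cx.X i)

theorem polyAntiderivative_d (N : DGLA K) (i j : ℤ) (x : N.polynomial.cx.X i) :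
    polyAntiderivative N j (N.polynomial.cx.d i j x) =
      N.polynomial.cx.d i j (polyAntiderivative N i x) :=
  rTensor_lTensor_comm _ (N.cx.d i j).hom x

theorem rTensor_derivative_antiderivative [CharZero K] {M : Type u} [AddCommGroup M]
    [Module K M] (x : K[X] ⊗[K] M) :
    (derivative : K[X] →ₗ[K] K[X]).rTensor M ((antiderivative K).rTensor M x) = x := by
  rw [← LinearMap.rTensor_comp_apply, derivative_comp_antiderivative, LinearMap.rTensor_id_apply]

theorem polyDerivation_polyAntiderivative [CharZero K] (N : DGLA K) (i : ℤ)
    (x : N.polynomial.cx.X i) : N.polyDerivation.map i (polyAntiderivative N i x) = x :=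
  rTensor_derivative_antiderivative (M := N.cx.X i) x

theorem rTensor_antiderivative_derivative [CharZero K] (N : DGLA K) (i : ℤ)
    (x : K[X] ⊗[K] N.cx.X i) :
    (antiderivative K).rTensor _ ((derivative : K[X] →ₗ[K] K[X]).rTensor _ x) =
      x - 1 ⊗ₜ polyEval N 0 i x := by
  rw [← LinearMap.rTensor_comp_apply, antiderivative_comp_derivative,
    LinearMap.rTensor_sub, LinearMap.rTensor_id, LinearMap.sub_apply, LinearMap.id_apply]
  congr 1
  induction x with
  | zero => simp only [map_zero, TensorProduct.tmul_zero]
  | add x y hx hy => simp only [map_add, TensorProduct.tmul_add, hx, hy]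
  | tmul p x =>
    rw [LinearMap.rTensor_tmul, polyEval_tmul, TensorProduct.tmul_smul, TensorProduct.smul_tmul']
    simp [Algebra.smul_def]

theorem polyAntiderivative_polyDerivation [CharZero K] (N : DGLA K) (i : ℤ)
    (x : N.polynomial.cx.X i) : polyAntiderivative N i (N.polyDerivation.map i x) =
      x - polyMul N 1 i ((polyEvalHom N 0).toHom.f i x) :=
  rTensor_antiderivative_derivative N i x

theorem polyEval_rTensor_antiderivative (N : DGLA K) (i : ℤ) (x : K[X] ⊗[K] N.cx.X i) :
    polyEval N 0 i ((antiderivative K).rTensor _ x) = 0 := by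
  rw [polyEval, LinearMap.comp_apply, ← LinearMap.rTensor_comp_apply, leval_comp_antiderivative,
    LinearMap.rTensor_zero, LinearMap.zero_apply, map_zero]

theorem polyEvalHom_polyAntiderivative (N : DGLA K) (i : ℤ) (x : N.polynomial.cx.X i) :
    (polyEvalHom N 0).toHom.f i (polyAntiderivative N i x) = 0 :=
  polyEval_rTensor_antiderivative N i x

/-- The composition of two morphisms. -/
def Hom.comp {L M N : DGLA K} (g : Hom M N) (f : Hom L M) : Hom L N where
  toHom := f.toHom ≫ g.toHom
  map_bracket i j k h x y := by
    change g.toHom.f k (f.toHom.f k _) = N.bracket i j k h (g.toHom.f i (f.toHom.f i x))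
      (g.toHom.f j (f.toHom.f j y))
    rw [f.map_bracket, g.map_bracket]

@[simp]
theorem Hom.comp_apply {L M N : DGLA K} (g : Hom M N) (f : Hom L M) (i : ℤ) (x : L.cx.X i) :
    (g.comp f).toHom.f i x = g.toHom.f i (f.toHom.f i x) := rfl

/-- The path object `N[t, dt]` of a DG-Lie algebra `N`. -/
def path (N : DGLA K) : DGLA K := N.polynomial.adjoinDt N.polyDerivation

/-- Evaluation `N[t, dt] → N` at `t = c`. -/
def pathEval (N : DGLA K) (c : K) : Hom N.path N :=
  (polyEvalHom N c).comp (N.polynomial.dtFst N.polyDerivation)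

/-- The constant paths. -/
def pathConst (N : DGLA K) : Hom N N.path :=
  N.polynomial.dtLift N.polyDerivation (polyConst N) fun i x => by
    rw [polyConst_apply, polyDerivation_polyMul, derivative_one, polyMul_zero]

/-- The action of `N ↦ N[t, dt]` on morphisms. -/
def pathMap {N M : DGLA K} (f : Hom N M) : Hom N.path M.path :=
  dtMap (polyMap f) (polyMap_polyDerivation f)

/-- The path `t ↦ t x`. -/
def line (N : DGLA K) (i : ℤ) : N.cx.X i →ₗ[K] N.path.cx.X i :=
  N.polynomial.dtInl N.polyDerivation i ∘ₗ N.polyMul X i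

/-- The element `dt x` of `N[t, dt]`. -/
def dtMul (N : DGLA K) (i : ℤ) : N.cx.X (i - 1) →ₗ[K] N.path.cx.X i :=
  N.polynomial.dtInr N.polyDerivation i ∘ₗ N.polyMul 1 (i - 1)

section API

variable (N : DGLA K)

@[simp]
theorem pathEval_const (c : K) (i : ℤ) (x : N.cx.X i) :
    (N.pathEval c).toHom.f i (N.pathConst.toHom.f i x) = x := by
  refine (polyEvalHom_polyMul N c 1 i x).trans ?_
  rw [eval_one, one_smul]

@[simp]
theorem pathEval_zero_line (i : ℤ) (x : N.cx.X i) :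
    (N.pathEval 0).toHom.f i (N.line i x) = 0 := by
  refine (polyEvalHom_polyMul N 0 X i x).trans ?_
  rw [eval_X, zero_smul]

@[simp]
theorem pathEval_one_line (i : ℤ) (x : N.cx.X i) :
    (N.pathEval 1).toHom.f i (N.line i x) = x := by
  refine (polyEvalHom_polyMul N 1 X i x).trans ?_
  rw [eval_X, one_smul]

@[simp]
theorem pathEval_dtMul (c : K) (i : ℤ) (x : N.cx.X (i - 1)) :
    (N.pathEval c).toHom.f i (N.dtMul i x) = 0 :=
  map_zero ((polyEvalHom N c).toHom.f i).hom

theorem d_line (i : ℤ) (x : N.cx.X i) (j : ℤ) (h : i = j - 1) :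
    N.path.cx.d i j (N.line i x) = N.line j (N.cx.d i j x) + N.dtMul j (tr N.cx h x) := by
  refine (d_dtInl N.polynomial N.polyDerivation i j h _).trans ?_
  rw [polyMul_d, polyDerivation_polyMul, derivative_X]
  subst h
  rfl

theorem d_dtMul (i j : ℤ) (h : i + 1 = j) (x : N.cx.X (i - 1)) :
    N.path.cx.d i j (N.dtMul i x) = -N.dtMul j (N.cx.d (i - 1) (j - 1) x) :=
  d_dtInr N.polynomial N.polyDerivation i j h _

theorem bracket_dtMul (i j k : ℤ) (h : i + j = k) (x : N.cx.X (i - 1)) (y : N.cx.X (j - 1)) :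
    N.path.bracket i j k h (N.dtMul i x) (N.dtMul j y) = 0 :=
  bracket_dtInr _ _ i j k h _ _

variable {N} {M : DGLA K} (f : Hom N M)

theorem pathEval_pathMap (c : K) (i : ℤ) (x : N.path.cx.X i) :
    (M.pathEval c).toHom.f i ((pathMap f).toHom.f i x) =
      f.toHom.f i ((N.pathEval c).toHom.f i x) :=
  (congrArg _ (dtFst_dtMap (polyMap f) (polyMap_polyDerivation f) i x)).trans
    (polyEvalHom_polyMap f c i _)

theorem pathMap_line (i : ℤ) (x : N.cx.X i) :
    (pathMap f).toHom.f i (N.line i x) = M.line i (f.toHom.f i x) :=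
  dtMap_dtInl (polyMap f) (polyMap_polyDerivation f) i _

theorem pathMap_dtMul (i : ℤ) (x : N.cx.X (i - 1)) :
    (pathMap f).toHom.f i (N.dtMul i x) = M.dtMul i (f.toHom.f (i - 1) x) :=
  dtMap_dtInr (polyMap f) (polyMap_polyDerivation f) i _

end API

/-- The Poincaré lemma: the kernel of evaluation at 0 on `N[t, dt]` is acyclic. For `γ = a + dt α`
the primitive is the integral of `α` from 0, which vanishes at 0 by construction. -/
theorem exists_path_primitive [CharZero K] (N : DGLA K) (i j : ℤ) (h : i + 1 = j)
    (γ : N.path.cx.X j) (hγ : ∀ k, N.path.cx.d j k γ = 0)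
    (h₀ : (N.pathEval 0).toHom.f j γ = 0) :
    ∃ η : N.path.cx.X i, N.path.cx.d i j η = γ ∧ (N.pathEval 0).toHom.f i η = 0 := by
  obtain ⟨b, hb⟩ := exists_dt_primitive (D := N.polyDerivation) (polyAntiderivative N)
    (polyAntiderivative_d N) (polyDerivation_polyAntiderivative N) i j h γ hγ (by
      -- Integrating the derivative of `a` gives `a - a(0)`, and `a(0)` is the value of `γ` at 0.
      rw [polyAntiderivative_polyDerivation]
      refine (congrArg (_ - ·) ((congrArg _ h₀).trans (map_zero (polyMul N 1 j)))).trans ?_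
      exact sub_zero _)
  exact ⟨_, hb, polyEvalHom_polyAntiderivative N i b⟩

end DGLA

end

/-! ### Kernels, products and homotopy fibres -/

noncomputable section

theorem CochainComplex.forall_d_eq_zero {K : Type u} [Field K]
    (A : CochainComplex (ModuleCat.{u} K) ℤ) {j k : ℤ} (h : j + 1 = k) {x : A.X j}
    (hx : A.d j k x = 0) (l : ℤ) : A.d j l x = 0 := by
  by_cases hl : j + 1 = l
  · obtain rfl : k = l := h.symm.trans hl
    exact hx
  · rw [A.shape _ _ hl]
    rfl

namespace SubDGLA

variable {K : Type u} [Field K] {L M : DGLA K}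

/-- The element of a sub-DG-Lie algebra given by an element of the ambient one. -/
def ofMem (S : SubDGLA L) {i : ℤ} (x : L.cx.X i) (hx : x ∈ S.carrier i) : S.toDGLA.cx.X i :=
  (⟨x, hx⟩ : S.carrier i)

theorem incl_mem (S : SubDGLA L) {i : ℤ} (x : S.toDGLA.cx.X i) :
    S.incl.toHom.f i x ∈ S.carrier i := Subtype.property (p := (· ∈ S.carrier i)) x

theorem incl_injective (S : SubDGLA L) {i : ℤ} {x y : S.toDGLA.cx.X i}
    (h : S.incl.toHom.f i x = S.incl.toHom.f i y) : x = y := Subtype.ext h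

/-- The elements on which two morphisms agree. -/
def equalizer (f g : DGLA.Hom L M) : SubDGLA L where
  carrier i := LinearMap.eqLocus (f.toHom.f i).hom (g.toHom.f i).hom
  d_mem i j x hx := by
    have hx' : f.toHom.f i x = g.toHom.f i x := hx
    change f.toHom.f j (L.cx.d i j x) = g.toHom.f j (L.cx.d i j x)
    rw [hom_d_apply, hom_d_apply, hx']
  bracket_mem i j k h x y hx hy := by
    have hx' : f.toHom.f i x = g.toHom.f i x := hx
    have hy' : f.toHom.f j y = g.toHom.f j y := hy
    change f.toHom.f k (L.bracket i j k h x y) = g.toHom.f k (L.bracket i j k h x y)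
    rw [f.map_bracket, g.map_bracket, hx', hy']

/-- The kernel of a morphism. -/
def ker (f : DGLA.Hom L M) : SubDGLA L where
  carrier i := LinearMap.ker (f.toHom.f i).hom
  d_mem i j x hx := by
    have hx' : f.toHom.f i x = 0 := hx
    change f.toHom.f j (L.cx.d i j x) = 0
    rw [hom_d_apply, hx', map_zero]
  bracket_mem i j k h x y hx hy := by
    have hx' : f.toHom.f i x = 0 := hx
    change f.toHom.f k (L.bracket i j k h x y) = 0
    rw [f.map_bracket, hx', map_zero, LinearMap.zero_apply]

end SubDGLA

namespace DGLA

variable {K : Type u} [Field K]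

section Prod

variable (L N : DGLA K)

/-- The product of two DG-Lie algebras. -/
def prod : DGLA K where
  cx :=
    { X := fun i => ModuleCat.of K (L.cx.X i × N.cx.X i)
      d := fun i j => ModuleCat.ofHom ((L.cx.d i j).hom.prodMap (N.cx.d i j).hom)
      shape := fun i j h => by
        rw [L.cx.shape i j h, N.cx.shape i j h]
        rfl
      d_comp_d' := fun i j k _ _ => ModuleCat.hom_ext (LinearMap.ext fun x =>
        Prod.ext (d_d_apply L.cx i j k _) (d_d_apply N.cx i j k _)) }
  bracket i j k h := LinearMap.mk₂ K
    (fun (x : L.cx.X i × N.cx.X i) (y : L.cx.X j × N.cx.X j) =>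
      ((L.bracket i j k h x.1 y.1, N.bracket i j k h x.2 y.2) : L.cx.X k × N.cx.X k))
    (fun x x' y => by simp)
    (fun c x y => by simp)
    (fun x y y' => by simp)
    (fun c x y => by simp)
  skew i j k h h' x y := Prod.ext (L.skew i j k h h' _ _) (N.skew i j k h h' _ _)
  jacobi i j l ij jl il n hij hjl hil h₁ h₂ h₃ x y z :=
    Prod.ext (L.jacobi i j l ij jl il n hij hjl hil h₁ h₂ h₃ _ _ _)
      (N.jacobi i j l ij jl il n hij hjl hil h₁ h₂ h₃ _ _ _)
  leibniz i j k i' j' k' h hi hj hk h₁ h₂ x y :=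
    Prod.ext (L.leibniz i j k i' j' k' h hi hj hk h₁ h₂ _ _)
      (N.leibniz i j k i' j' k' h hi hj hk h₁ h₂ _ _)

/-- The first projection. -/
def prodFst : Hom (L.prod N) L where
  toHom :=
    { f := fun i => ModuleCat.ofHom (LinearMap.fst K (L.cx.X i) (N.cx.X i))
      comm' := fun _ _ _ => rfl }
  map_bracket _ _ _ _ _ _ := rfl

/-- The second projection. -/
def prodSnd : Hom (L.prod N) N where
  toHom :=
    { f := fun i => ModuleCat.ofHom (LinearMap.snd K (L.cx.X i) (N.cx.X i))
      comm' := fun _ _ _ => rfl }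
  map_bracket _ _ _ _ _ _ := rfl

variable {L N}

/-- The element of the product with given components. -/
def prodMk {i : ℤ} (x : L.cx.X i) (y : N.cx.X i) : (L.prod N).cx.X i :=
  ((x, y) : L.cx.X i × N.cx.X i)

theorem prod_ext {i : ℤ} {x y : (L.prod N).cx.X i}
    (h₁ : (L.prodFst N).toHom.f i x = (L.prodFst N).toHom.f i y)
    (h₂ : (L.prodSnd N).toHom.f i x = (L.prodSnd N).toHom.f i y) : x = y :=
  Prod.ext h₁ h₂

/-- The morphism to a product with given components. -/
def prodLift {A : DGLA K} (f : Hom A L) (g : Hom A N) : Hom A (L.prod N) where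
  toHom :=
    { f := fun i => ModuleCat.ofHom ((f.toHom.f i).hom.prod (g.toHom.f i).hom)
      comm' := fun i j _ => ModuleCat.hom_ext (LinearMap.ext fun x =>
        Prod.ext (hom_d_apply f.toHom i j x).symm (hom_d_apply g.toHom i j x).symm) }
  map_bracket i j k h x y := Prod.ext (f.map_bracket i j k h x y) (g.map_bracket i j k h x y)

end Prod

section Hofib

variable {L N : DGLA K} (f : Hom L N)

/-- The homotopy fiber `{(x, γ) | γ 0 = 0, γ 1 = f x}`, as a sub-DG-Lie algebra of
`L × N[t, dt]`. -/
def hofibSub : SubDGLA (L.prod N.path) :=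
  (SubDGLA.ker ((N.pathEval 0).comp (L.prodSnd N.path))).inter
    (SubDGLA.equalizer ((N.pathEval 1).comp (L.prodSnd N.path)) (f.comp (L.prodFst N.path)))

/-- The homotopy fiber `{(x, γ) | γ 0 = 0, γ 1 = f x}` of a morphism. -/
def hofib : DGLA K := (hofibSub f).toDGLA

/-- The projection `(x, γ) ↦ x`. -/
def hofibFst : Hom (hofib f) L := (L.prodFst N.path).comp (hofibSub f).incl

/-- The projection `(x, γ) ↦ γ`. -/
def hofibPath : Hom (hofib f) N.path := (L.prodSnd N.path).comp (hofibSub f).incl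

variable {f}

theorem hofib_ext {i : ℤ} {x y : (hofib f).cx.X i}
    (h₁ : (hofibFst f).toHom.f i x = (hofibFst f).toHom.f i y)
    (h₂ : (hofibPath f).toHom.f i x = (hofibPath f).toHom.f i y) : x = y :=
  (hofibSub f).incl_injective (prod_ext h₁ h₂)

@[simp]
theorem pathEval_zero_hofibPath {i : ℤ} (x : (hofib f).cx.X i) :
    (N.pathEval 0).toHom.f i ((hofibPath f).toHom.f i x) = 0 :=
  ((hofibSub f).incl_mem x).1

@[simp]
theorem pathEval_one_hofibPath {i : ℤ} (x : (hofib f).cx.X i) :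
    (N.pathEval 1).toHom.f i ((hofibPath f).toHom.f i x) =
      f.toHom.f i ((hofibFst f).toHom.f i x) :=
  ((hofibSub f).incl_mem x).2

variable (f) in
/-- The element `(x, γ)` of the homotopy fiber. -/
def hofibMk {i : ℤ} (x : L.cx.X i) (γ : N.path.cx.X i) (h₀ : (N.pathEval 0).toHom.f i γ = 0)
    (h₁ : (N.pathEval 1).toHom.f i γ = f.toHom.f i x) : (hofib f).cx.X i :=
  (hofibSub f).ofMem (prodMk x γ) ⟨h₀, h₁⟩

@[simp]
theorem hofibFst_mk {i : ℤ} (x : L.cx.X i) (γ : N.path.cx.X i)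
    (h₀ : (N.pathEval 0).toHom.f i γ = 0)
    (h₁ : (N.pathEval 1).toHom.f i γ = f.toHom.f i x) :
    (hofibFst f).toHom.f i (hofibMk f x γ h₀ h₁) = x := rfl

@[simp]
theorem hofibPath_mk {i : ℤ} (x : L.cx.X i) (γ : N.path.cx.X i)
    (h₀ : (N.pathEval 0).toHom.f i γ = 0)
    (h₁ : (N.pathEval 1).toHom.f i γ = f.toHom.f i x) :
    (hofibPath f).toHom.f i (hofibMk f x γ h₀ h₁) = γ := rfl

variable (f) in
/-- The morphism to the homotopy fiber with given components. -/
def hofibLift {A : DGLA K} (a : Hom A L) (p : Hom A N.path)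
    (h₀ : ∀ i x, (N.pathEval 0).toHom.f i (p.toHom.f i x) = 0)
    (h₁ : ∀ i x, (N.pathEval 1).toHom.f i (p.toHom.f i x) = f.toHom.f i (a.toHom.f i x)) :
    Hom A (hofib f) :=
  (hofibSub f).codRestrictHom (prodLift a p) fun i x => ⟨h₀ i x, h₁ i x⟩

section

variable {A : DGLA K} (a : Hom A L) (p : Hom A N.path)
  (h₀ : ∀ i x, (N.pathEval 0).toHom.f i (p.toHom.f i x) = 0)
  (h₁ : ∀ i x, (N.pathEval 1).toHom.f i (p.toHom.f i x) = f.toHom.f i (a.toHom.f i x))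

end

/-- The morphism on homotopy fibers induced by a commutative square. -/
def hofibMap {L' N' : DGLA K} {f' : Hom L' N'} (a : Hom L L') (b : Hom N N')
    (h : ∀ i x, f'.toHom.f i (a.toHom.f i x) = b.toHom.f i (f.toHom.f i x)) :
    Hom (hofib f) (hofib f') :=
  hofibLift f' (a.comp (hofibFst f)) ((pathMap b).comp (hofibPath f))
    (fun i x => by
      rw [Hom.comp_apply, pathEval_pathMap, pathEval_zero_hofibPath, map_zero])
    (fun i x => by
      rw [Hom.comp_apply, pathEval_pathMap, pathEval_one_hofibPath, Hom.comp_apply, h])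

@[simp]
theorem hofibFst_map {L' N' : DGLA K} {f' : Hom L' N'} (a : Hom L L') (b : Hom N N')
    (h : ∀ i x, f'.toHom.f i (a.toHom.f i x) = b.toHom.f i (f.toHom.f i x)) (i : ℤ)
    (x : (hofib f).cx.X i) : (hofibFst f').toHom.f i ((hofibMap a b h).toHom.f i x) =
      a.toHom.f i ((hofibFst f).toHom.f i x) := rfl

@[simp]
theorem hofibPath_map {L' N' : DGLA K} {f' : Hom L' N'} (a : Hom L L') (b : Hom N N')
    (h : ∀ i x, f'.toHom.f i (a.toHom.f i x) = b.toHom.f i (f.toHom.f i x)) (i : ℤ)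
    (x : (hofib f).cx.X i) : (hofibPath f').toHom.f i ((hofibMap a b h).toHom.f i x) =
      (pathMap b).toHom.f i ((hofibPath f).toHom.f i x) := rfl

end Hofib

/-! ### Homotopy cartesian squares and maps of homotopy fibres -/

/-- A square of complexes is homotopy cartesian: its total complex is acyclic. -/
def HomotopyCartesian {A B A' B' : CochainComplex (ModuleCat.{u} K) ℤ} (f : A ⟶ B)
    (f' : A' ⟶ B') (a : A ⟶ A') (b : B ⟶ B') : Prop :=
  ∀ (m i j k : ℤ), m + 1 = i → i + 1 = j → j + 1 = k →
    ∀ (x : A.X k) (y : B.X j) (x' : A'.X j) (y' : B'.X i),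
      (∀ l, A.d k l x = 0) → B.d j k y = f.f k x → A'.d j k x' = a.f k x →
      B'.d i j y' = f'.f j x' - b.f j y →
        ∃ (u : A.X j) (v : B.X i) (u' : A'.X i) (v' : B'.X m),
          A.d j k u = x ∧ f.f j u + B.d i j v = y ∧ a.f j u + A'.d i j u' = x' ∧
            f'.f i u' - b.f i v + B'.d m i v' = y'

/-- The total complex is a cone of a map between the cones of `a` and `b`, both of which are
acyclic. In elements, the cone condition for `a` is solved first and the remaining error is then
handled by the one for `b`. -/
theorem homotopyCartesian_of_quasiIso {A B A' B' : CochainComplex (ModuleCat.{u} K) ℤ}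
    {f : A ⟶ B} {f' : A' ⟶ B'} {a : A ⟶ A'} {b : B ⟶ B'} (h : a ≫ f' = f ≫ b)
    (ha : QuasiIso a) (hb : QuasiIso b) : HomotopyCartesian f f' a b := by
  rw [quasiIso_iff_forall_exists] at ha hb
  have h' (i : ℤ) (x : A.X i) : f'.f i (a.f i x) = b.f i (f.f i x) :=
    congrArg (fun φ => φ.f i x) h
  intro m i j k hm hi hj x y x' y' hx hy hx' hy'
  obtain ⟨u, u', hu, hu'⟩ := ha i j k hi hj x x' hx hx'.symm
  -- Here `y - f u` is a cocycle. Since `b f u = f' a u = f' x' - d (f' u')`, its image under `b` is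
  -- `d (f' u' - y')`.
  obtain ⟨v, v', hv, hv'⟩ := hb m i j hm hi (y - f.f j u) (f'.f i u' - y')
    (B.forall_d_eq_zero hj (by rw [map_sub, hy, ← hom_d_apply, hu, sub_self]))
    (by
      rw [map_sub, map_sub, hy', ← hu', map_add, h', hom_d_apply]
      abel)
  refine ⟨u, v, u', -v', hu, by rw [hv]; abel, hu', ?_⟩
  rw [map_neg, sub_add, sub_neg_eq_add, hv']
  abel

/-- Path components that vanish at 0 are acyclic, so only endpoints at `t = 1` carry an obstruction.
Integrating the paths turns the lifting problem for the homotopy fibres into the one for the total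
complex of the square. -/
theorem isWeakEquiv_hofibMap [CharZero K] {L N L' N' : DGLA K} {f : Hom L N} {f' : Hom L' N'}
    (a : Hom L L') (b : Hom N N')
    (h : ∀ i x, f'.toHom.f i (a.toHom.f i x) = b.toHom.f i (f.toHom.f i x))
    (hc : HomotopyCartesian f.toHom f'.toHom a.toHom b.toHom) :
    (hofibMap a b h).IsWeakEquiv := by
  refine (quasiIso_iff_forall_exists _).2 fun i j k hi hj z w hz hw => ?_
  obtain ⟨m, hm⟩ : ∃ m : ℤ, m + 1 = i := ⟨i - 1, by omega⟩
  have hzx (l : ℤ) : L.cx.d k l ((hofibFst f).toHom.f k z) = 0 := by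
    rw [← hom_d_apply, hz, map_zero]
  have hzγ (l : ℤ) : N.path.cx.d k l ((hofibPath f).toHom.f k z) = 0 := by
    rw [← hom_d_apply, hz, map_zero]
  have hwx : a.toHom.f k ((hofibFst f).toHom.f k z) =
      L'.cx.d j k ((hofibFst f').toHom.f j w) := by
    rw [← hom_d_apply, ← hw, hofibFst_map]
  have hwγ : (pathMap b).toHom.f k ((hofibPath f).toHom.f k z) =
      N'.path.cx.d j k ((hofibPath f').toHom.f j w) := by
    rw [← hom_d_apply, ← hw, hofibPath_map]
  -- `η` integrates the path of `z`, and `η'` below integrates the difference between the path of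
  -- `w` and the image of `η`. Both start at 0, but their endpoints need not come from `L` and `L'`.
  obtain ⟨η, hη, hη₀⟩ := exists_path_primitive N j k hj _ hzγ (pathEval_zero_hofibPath z)
  obtain ⟨η', hη', hη'₀⟩ := exists_path_primitive N' i j hi
    ((hofibPath f').toHom.f j w - (pathMap b).toHom.f j η)
    (forall_d_eq_zero _ hj (by rw [map_sub, ← hwγ, ← hom_d_apply, hη, sub_self]))
    (by rw [map_sub, pathEval_zero_hofibPath, pathEval_pathMap, hη₀, map_zero, sub_self])
  -- The values of `η` and `η'` at 1, together with the `L`- and `L'`-components of `z` and `w`,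
  -- form a cocycle of the total complex.
  obtain ⟨x, v, x', v', hx, hv, hx', hv'⟩ := hc m i j k hm hi hj
    ((hofibFst f).toHom.f k z) ((N.pathEval 1).toHom.f j η) ((hofibFst f').toHom.f j w)
    ((N'.pathEval 1).toHom.f i η') hzx
    (by rw [← hom_d_apply, hη, pathEval_one_hofibPath]) hwx.symm
    (by rw [← hom_d_apply, hη', map_sub, pathEval_one_hofibPath, pathEval_pathMap])
  -- Subtracting `d (t v)` moves the endpoint of `η` at 1 by `d v` and changes neither its value at
  -- 0 nor its differential. The term `t b(v)` added to `η'` compensates for this in the target, and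
  -- `d (t v')` adjusts the endpoint of `η'`.
  have h₁ : (N.pathEval 0).toHom.f j (η - N.path.cx.d i j (N.line i v)) = 0 := by
    rw [map_sub, hη₀, hom_d_apply, pathEval_zero_line, map_zero, sub_zero]
  have h₂ : (N.pathEval 1).toHom.f j (η - N.path.cx.d i j (N.line i v)) = f.toHom.f j x := by
    rw [map_sub, hom_d_apply, pathEval_one_line, ← hv, add_sub_cancel_right]
  have h₃ : (N'.pathEval 0).toHom.f i
      (η' + N'.line i (b.toHom.f i v) - N'.path.cx.d m i (N'.line m v')) = 0 := by
    rw [map_sub, map_add, hη'₀, hom_d_apply, pathEval_zero_line, pathEval_zero_line, map_zero,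
      sub_zero, add_zero]
  have h₄ : (N'.pathEval 1).toHom.f i
      (η' + N'.line i (b.toHom.f i v) - N'.path.cx.d m i (N'.line m v')) = f'.toHom.f i x' := by
    rw [map_sub, map_add, hom_d_apply, pathEval_one_line, pathEval_one_line, ← hv']
    abel
  refine ⟨hofibMk f x _ h₁ h₂, hofibMk f' x' _ h₃ h₄, hofib_ext ?_ ?_, hofib_ext ?_ ?_⟩
  · rw [hom_d_apply, hofibFst_mk, hx]
  · rw [hom_d_apply, hofibPath_mk, map_sub, hη, d_d_apply, sub_zero]
  · refine (map_add _ _ _).trans ?_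
    rw [hom_d_apply, hofibFst_map, hofibFst_mk, hofibFst_mk, hx']
  · refine (map_add _ _ _).trans ?_
    rw [hom_d_apply, hofibPath_map, hofibPath_mk, hofibPath_mk, map_sub, map_sub,
      map_add, d_d_apply, hη', hom_d_apply, pathMap_line]
    abel

end DGLA

end

/-! ### Mapping path spaces and strict kernels -/

noncomputable section

theorem CochainComplex.hom_ext_apply {K : Type u} [Field K]
    {A B : CochainComplex (ModuleCat.{u} K) ℤ} {f g : A ⟶ B}
    (h : ∀ i (x : A.X i), f.f i x = g.f i x) : f = g :=
  HomologicalComplex.hom_ext _ _ fun i => ModuleCat.hom_ext (LinearMap.ext (h i))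

theorem CochainComplex.congr_hom_apply {K : Type u} [Field K]
    {A B : CochainComplex (ModuleCat.{u} K) ℤ} {f g : A ⟶ B} (h : f = g) (i : ℤ) (x : A.X i) :
    f.f i x = g.f i x := by rw [h]

namespace DGLA

variable {K : Type u} [Field K]

/-- The identity morphism. -/
def Hom.id (L : DGLA K) : Hom L L where
  toHom := 𝟙 _
  map_bracket _ _ _ _ _ _ := rfl

/-- The zero morphism. -/
def Hom.zero (L N : DGLA K) : Hom L N where
  toHom := 0
  map_bracket i j k h x y := by
    change 0 = N.bracket i j k h 0 0
    rw [map_zero]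

@[simp]
theorem Hom.zero_apply (L N : DGLA K) (i : ℤ) (x : L.cx.X i) :
    (Hom.zero L N).toHom.f i x = 0 := rfl

@[ext]
theorem Hom.ext_apply {L N : DGLA K} {f g : Hom L N}
    (h : ∀ i x, f.toHom.f i x = g.toHom.f i x) : f = g := by
  obtain ⟨f, _⟩ := f
  obtain ⟨g, _⟩ := g
  obtain rfl : f = g := hom_ext_apply h
  rfl

theorem polyMap_comp_apply {L M N : DGLA K} (g : Hom M N) (f : Hom L M) (i : ℤ)
    (x : L.polynomial.cx.X i) : (polyMap (g.comp f)).toHom.f i x =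
      (polyMap g).toHom.f i ((polyMap f).toHom.f i x) :=
  LinearMap.lTensor_comp_apply _ (g.toHom.f i).hom (f.toHom.f i).hom x

theorem pathMap_comp_apply {L M N : DGLA K} (g : Hom M N) (f : Hom L M) (i : ℤ)
    (x : L.path.cx.X i) : (pathMap (g.comp f)).toHom.f i x =
      (pathMap g).toHom.f i ((pathMap f).toHom.f i x) := by
  refine dt_ext ?_ ?_
  · refine (dtFst_dtMap _ (polyMap_polyDerivation _) i x).trans ((polyMap_comp_apply g f i _).trans ?_)
    exact ((dtFst_dtMap _ (polyMap_polyDerivation g) i _).trans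
      (congrArg _ (dtFst_dtMap _ (polyMap_polyDerivation f) i x))).symm
  · refine (dtSnd_dtMapLinear _ i x).trans ((polyMap_comp_apply g f (i - 1) _).trans ?_)
    exact ((dtSnd_dtMapLinear (polyMap g) i _).trans
      (congrArg _ (dtSnd_dtMapLinear (polyMap f) i x))).symm

theorem hofibMap_comm {L₁ L₂ L₃ L₄ N₁ N₂ N₃ N₄ : DGLA K} {f₁ : Hom L₁ N₁} {f₂ : Hom L₂ N₂}
    {f₃ : Hom L₃ N₃} {f₄ : Hom L₄ N₄}
    {a : Hom L₁ L₂} {a' : Hom L₂ L₄} {c : Hom L₁ L₃} {c' : Hom L₃ L₄}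
    {b : Hom N₁ N₂} {b' : Hom N₂ N₄} {e : Hom N₁ N₃} {e' : Hom N₃ N₄}
    (hab : ∀ i x, f₂.toHom.f i (a.toHom.f i x) = b.toHom.f i (f₁.toHom.f i x))
    (hab' : ∀ i x, f₄.toHom.f i (a'.toHom.f i x) = b'.toHom.f i (f₂.toHom.f i x))
    (hce : ∀ i x, f₃.toHom.f i (c.toHom.f i x) = e.toHom.f i (f₁.toHom.f i x))
    (hce' : ∀ i x, f₄.toHom.f i (c'.toHom.f i x) = e'.toHom.f i (f₃.toHom.f i x))
    (ha : a'.comp a = c'.comp c) (hb : b'.comp b = e'.comp e) (i : ℤ)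
    (x : (hofib f₁).cx.X i) :
    (hofibMap a' b' hab').toHom.f i ((hofibMap a b hab).toHom.f i x) =
      (hofibMap c' e' hce').toHom.f i ((hofibMap c e hce).toHom.f i x) := by
  refine hofib_ext ?_ ?_
  · rw [hofibFst_map, hofibFst_map, hofibFst_map, hofibFst_map, ← Hom.comp_apply, ha,
      Hom.comp_apply]
  · rw [hofibPath_map, hofibPath_map, hofibPath_map, hofibPath_map, ← pathMap_comp_apply, hb,
      pathMap_comp_apply]

section PathSpace

variable {L N : DGLA K} (f : Hom L N)

/-- The mapping path space `{(x, γ) | γ 0 = f x}`, as a sub-DG-Lie algebra of `L × N[t, dt]`. -/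
def pathSpaceSub : SubDGLA (L.prod N.path) :=
  SubDGLA.equalizer ((N.pathEval 0).comp (L.prodSnd N.path)) (f.comp (L.prodFst N.path))

/-- The mapping path space `{(x, γ) | γ 0 = f x}` of a morphism. -/
def pathSpace : DGLA K := (pathSpaceSub f).toDGLA

/-- The projection `(x, γ) ↦ x`. -/
def pathSpaceFst : Hom (pathSpace f) L := (L.prodFst N.path).comp (pathSpaceSub f).incl

/-- The projection `(x, γ) ↦ γ`. -/
def pathSpacePath : Hom (pathSpace f) N.path := (L.prodSnd N.path).comp (pathSpaceSub f).incl

variable {f} in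
theorem pathSpace_ext {i : ℤ} {x y : (pathSpace f).cx.X i}
    (h₁ : (pathSpaceFst f).toHom.f i x = (pathSpaceFst f).toHom.f i y)
    (h₂ : (pathSpacePath f).toHom.f i x = (pathSpacePath f).toHom.f i y) : x = y :=
  (pathSpaceSub f).incl_injective (prod_ext h₁ h₂)

/-- The element `(x, γ)` of the mapping path space. -/
def pathSpaceMk {i : ℤ} (x : L.cx.X i) (γ : N.path.cx.X i)
    (h : (N.pathEval 0).toHom.f i γ = f.toHom.f i x) : (pathSpace f).cx.X i :=
  (pathSpaceSub f).ofMem (prodMk x γ) h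

@[simp]
theorem pathSpaceFst_mk {i : ℤ} (x : L.cx.X i) (γ : N.path.cx.X i)
    (h : (N.pathEval 0).toHom.f i γ = f.toHom.f i x) :
    (pathSpaceFst f).toHom.f i (pathSpaceMk f x γ h) = x := rfl

@[simp]
theorem pathSpacePath_mk {i : ℤ} (x : L.cx.X i) (γ : N.path.cx.X i)
    (h : (N.pathEval 0).toHom.f i γ = f.toHom.f i x) :
    (pathSpacePath f).toHom.f i (pathSpaceMk f x γ h) = γ := rfl

theorem pathEval_zero_pathSpacePath {i : ℤ} (x : (pathSpace f).cx.X i) :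
    (N.pathEval 0).toHom.f i ((pathSpacePath f).toHom.f i x) =
      f.toHom.f i ((pathSpaceFst f).toHom.f i x) :=
  (pathSpaceSub f).incl_mem x

/-- The inclusion `x ↦ (x, f x)` of the constant paths. -/
def pathSpaceConst : Hom L (pathSpace f) :=
  (pathSpaceSub f).codRestrictHom (prodLift (Hom.id L) (N.pathConst.comp f)) fun i x =>
    pathEval_const N 0 i (f.toHom.f i x)

@[simp]
theorem pathSpaceFst_const (i : ℤ) (x : L.cx.X i) :
    (pathSpaceFst f).toHom.f i ((pathSpaceConst f).toHom.f i x) = x := rfl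

@[simp]
theorem pathSpacePath_const (i : ℤ) (x : L.cx.X i) :
    (pathSpacePath f).toHom.f i ((pathSpaceConst f).toHom.f i x) =
      N.pathConst.toHom.f i (f.toHom.f i x) := rfl

/-- The evaluation `(x, γ) ↦ γ 1`. -/
def pathSpaceEval : Hom (pathSpace f) N := (N.pathEval 1).comp (pathSpacePath f)

@[simp]
theorem pathSpaceEval_const (i : ℤ) (x : L.cx.X i) :
    (pathSpaceEval f).toHom.f i ((pathSpaceConst f).toHom.f i x) = f.toHom.f i x :=
  pathEval_const N 1 i (f.toHom.f i x)

/-- The straight line `t n` over the point 0 ends at `n`. -/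
theorem isFibration_pathSpaceEval : (pathSpaceEval f).IsFibration := fun i n =>
  ⟨pathSpaceMk f 0 (N.line i n) (by rw [pathEval_zero_line, map_zero]), pathEval_one_line N i n⟩

/-- A point `(x, γ)` differs from the constant path at `f x` by a path that vanishes at 0, and such
paths form an acyclic complex. -/
theorem isWeakEquiv_pathSpaceConst [CharZero K] : (pathSpaceConst f).IsWeakEquiv := by
  refine (quasiIso_iff_forall_exists _).2 fun i j k hi hj x w hx hw => ?_
  have hw₁ : x = L.cx.d j k ((pathSpaceFst f).toHom.f j w) := by
    rw [← hom_d_apply, ← hw, pathSpaceFst_const]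
  have hw₂ : N.pathConst.toHom.f k (f.toHom.f k x) =
      N.path.cx.d j k ((pathSpacePath f).toHom.f j w) := by
    rw [← hom_d_apply, ← hw, pathSpacePath_const]
  obtain ⟨η, hη, hη₀⟩ := exists_path_primitive N i j hi
    ((pathSpacePath f).toHom.f j w -
      N.pathConst.toHom.f j (f.toHom.f j ((pathSpaceFst f).toHom.f j w)))
    (forall_d_eq_zero _ hj (by
      rw [map_sub, ← hw₂, ← hom_d_apply, ← hom_d_apply, ← hw₁, sub_self]))
    (by rw [map_sub, pathEval_const, pathEval_zero_pathSpacePath, sub_self])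
  have hη' : (N.pathEval 0).toHom.f i η = f.toHom.f i 0 := by rw [hη₀, map_zero]
  refine ⟨(pathSpaceFst f).toHom.f j w, pathSpaceMk f 0 η hη', hw₁.symm, pathSpace_ext ?_ ?_⟩
  · refine (map_add _ _ _).trans ?_
    rw [hom_d_apply, pathSpaceFst_mk, pathSpaceFst_const, map_zero, add_zero]
  · refine (map_add _ _ _).trans ?_
    rw [hom_d_apply, pathSpacePath_mk, pathSpacePath_const, hη, add_sub_cancel]

end PathSpace

section Kernel

variable {A L N : DGLA K} (f : Hom L N) (e : Hom A L)
  (he : ∀ i x, f.toHom.f i (e.toHom.f i x) = 0)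

/-- A morphism with composite zero with `f`, as a morphism to the homotopy fiber of `f`. -/
def toHofib : Hom A (hofib f) :=
  hofibLift f e (Hom.zero A N.path)
    (fun i x => by rw [Hom.zero_apply, map_zero])
    (fun i x => by rw [Hom.zero_apply, map_zero, he])

/-- The hypotheses identify `A` with the strict kernel of `f`. Given `(l, γ)` with `γ` closed,
integrate `γ` to `η` from 0 and lift `η(1)` to `u` by surjectivity; then `l - d u` lies in the
kernel of `f` and differs from `(l, γ)` by the boundary of `(u, η)`. -/
theorem isWeakEquiv_toHofib [CharZero K] (hf : f.IsFibration)
    (hinj : ∀ i, Function.Injective (e.toHom.f i))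
    (hker : ∀ i x, f.toHom.f i x = 0 → ∃ a, e.toHom.f i a = x) :
    (toHofib f e he).IsWeakEquiv := by
  refine (quasiIso_iff_forall_exists _).2 fun i j k hi hj x w hx hw => ?_
  have hw₁ : e.toHom.f k x = L.cx.d j k ((hofibFst f).toHom.f j w) := by
    rw [← hom_d_apply, ← hw]
    rfl
  have hw₂ : N.path.cx.d j k ((hofibPath f).toHom.f j w) = 0 := by
    rw [← hom_d_apply, ← hw]
    rfl
  obtain ⟨η, hη, hη₀⟩ := exists_path_primitive N i j hi _ (forall_d_eq_zero _ hj hw₂)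
    (pathEval_zero_hofibPath w)
  obtain ⟨u, hu⟩ := hf i ((N.pathEval 1).toHom.f i η)
  obtain ⟨a, ha⟩ := hker j ((hofibFst f).toHom.f j w - L.cx.d i j u) (by
    rw [map_sub, hom_d_apply, hu, ← hom_d_apply, hη, pathEval_one_hofibPath, sub_self])
  refine ⟨a, hofibMk f u η hη₀ hu.symm, hinj k ?_, hofib_ext ?_ ?_⟩
  · rw [hom_d_apply, ha, map_sub, d_d_apply, hw₁, sub_zero]
  · refine (map_add _ _ _).trans ?_
    rw [hom_d_apply, hofibFst_mk]
    change e.toHom.f j a + _ = _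
    rw [ha, sub_add_cancel]
  · refine (map_add _ _ _).trans ?_
    rw [hom_d_apply, hofibPath_mk, hη]
    exact zero_add _

end Kernel

theorem HomotopyEquivalent.of_hom {L M : DGLA K} (f : Hom L M) (hf : f.IsWeakEquiv) :
    HomotopyEquivalent L M :=
  Relation.EqvGen.rel _ _ ⟨f, hf⟩

theorem HomotopyEquivalent.symm {L M : DGLA K} (h : HomotopyEquivalent L M) :
    HomotopyEquivalent M L :=
  Relation.EqvGen.symm _ _ h

theorem HomotopyEquivalent.trans {L M N : DGLA K} (h : HomotopyEquivalent L M)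
    (h' : HomotopyEquivalent M N) : HomotopyEquivalent L N :=
  Relation.EqvGen.trans _ _ _ h h'

end DGLA

/-! ### Fibrant replacement and the iterated homotopy fibre of a square -/

namespace DGLASquare

open DGLA

variable {K : Type u} [Field K] (S : DGLASquare K)

theorem comm_apply (i : ℤ) (x : S.g₀₀.cx.X i) :
    S.h₁.toHom.f i (S.v₀.toHom.f i x) = S.v₁.toHom.f i (S.h₀.toHom.f i x) :=
  (congr_hom_apply S.comm i x).symm

/-- The pullback of the mapping path spaces of `h₁` and `v₁`. -/
def matchingSub : SubDGLA ((pathSpace S.h₁).prod (pathSpace S.v₁)) :=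
  SubDGLA.equalizer ((pathSpaceEval S.h₁).comp (prodFst _ _))
    ((pathSpaceEval S.v₁).comp (prodSnd _ _))

/-- The morphism from `g₀₀` to the pullback of the mapping path spaces of `h₁` and `v₁`. -/
def toMatching : DGLA.Hom S.g₀₀ S.matchingSub.toDGLA :=
  S.matchingSub.codRestrictHom
    (prodLift ((pathSpaceConst S.h₁).comp S.v₀) ((pathSpaceConst S.v₁).comp S.h₀)) fun i x => by
    change (pathSpaceEval S.h₁).toHom.f i ((pathSpaceConst S.h₁).toHom.f i (S.v₀.toHom.f i x)) =
      (pathSpaceEval S.v₁).toHom.f i ((pathSpaceConst S.v₁).toHom.f i (S.h₀.toHom.f i x))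
    rw [pathSpaceEval_const, pathSpaceEval_const, comm_apply]

/-- The fibrant replacement of a square by mapping path spaces. -/
def fibrantReplacement : DGLASquare K where
  g₀₀ := pathSpace S.toMatching
  g₀₁ := pathSpace S.v₁
  g₁₀ := pathSpace S.h₁
  g₁₁ := S.g₁₁
  h₀ := ((prodSnd _ _).comp S.matchingSub.incl).comp (pathSpaceEval S.toMatching)
  v₀ := ((prodFst _ _).comp S.matchingSub.incl).comp (pathSpaceEval S.toMatching)
  v₁ := pathSpaceEval S.v₁
  h₁ := pathSpaceEval S.h₁
  comm := hom_ext_apply fun _ x =>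
    (S.matchingSub.incl_mem ((pathSpaceEval S.toMatching).toHom.f _ x)).symm

/-- The fibre product of the replaced corner is `matchingSub`, and the new `g₀₀` maps to it by
evaluation on a mapping path space. All three conditions are thus instances of
`isFibration_pathSpaceEval`. -/
theorem isFibrant_fibrantReplacement : S.fibrantReplacement.IsFibrant := by
  refine ⟨isFibration_pathSpaceEval _, isFibration_pathSpaceEval _, fun i x y h => ?_⟩
  obtain ⟨z, hz⟩ := isFibration_pathSpaceEval S.toMatching i
    (S.matchingSub.ofMem (prodMk x y) h)
  exact ⟨z, congrArg (fun w => (prodFst _ _).toHom.f i (S.matchingSub.incl.toHom.f i w)) hz,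
    congrArg (fun w => (prodSnd _ _).toHom.f i (S.matchingSub.incl.toHom.f i w)) hz⟩

/-- The morphism from a square to its fibrant replacement. -/
def toFibrantReplacement : Hom S S.fibrantReplacement where
  f₀₀ := pathSpaceConst S.toMatching
  f₀₁ := pathSpaceConst S.v₁
  f₁₀ := pathSpaceConst S.h₁
  f₁₁ := DGLA.Hom.id S.g₁₁
  comm_h₀ := hom_ext_apply fun i x => by
    change _ = (prodSnd _ _).toHom.f i (S.matchingSub.incl.toHom.f i
      ((pathSpaceEval S.toMatching).toHom.f i ((pathSpaceConst S.toMatching).toHom.f i x)))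
    rw [pathSpaceEval_const]
    rfl
  comm_v₀ := hom_ext_apply fun i x => by
    change _ = (prodFst _ _).toHom.f i (S.matchingSub.incl.toHom.f i
      ((pathSpaceEval S.toMatching).toHom.f i ((pathSpaceConst S.toMatching).toHom.f i x)))
    rw [pathSpaceEval_const]
    rfl
  comm_v₁ := hom_ext_apply fun i x => (pathSpaceEval_const S.v₁ i x).symm
  comm_h₁ := hom_ext_apply fun i x => (pathSpaceEval_const S.h₁ i x).symm

/-- Every square has a fibrant resolution. -/
def fibrantResolution [CharZero K] : S.FibrantResolution where
  target := S.fibrantReplacement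
  map := S.toFibrantReplacement
  isWeakEquiv := ⟨isWeakEquiv_pathSpaceConst _, isWeakEquiv_pathSpaceConst _,
    isWeakEquiv_pathSpaceConst _, (inferInstance : QuasiIso (𝟙 S.g₁₁.cx))⟩
  isFibrant := S.isFibrant_fibrantReplacement

/-- The morphism from the homotopy fiber of `v₀` to the homotopy fiber of `v₁`. -/
def hofibHorizontal : DGLA.Hom (hofib S.v₀) (hofib S.v₁) :=
  hofibMap S.h₀ S.h₁ fun i x => (S.comm_apply i x).symm

/-- The iterated homotopy fiber of a square. -/
def iteratedHofib : DGLA K := hofib S.hofibHorizontal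

variable {S} in
-- Invariance of homotopy fibres is applied twice: to the two vertical maps, and then to the induced
-- map between their homotopy fibres.
theorem Hom.homotopyEquivalent_iteratedHofib [CharZero K] {T : DGLASquare K} (f : Hom S T)
    (hf : f.IsWeakEquiv) : HomotopyEquivalent S.iteratedHofib T.iteratedHofib := by
  obtain ⟨h₀₀, h₀₁, h₁₀, h₁₁⟩ := hf
  refine .of_hom (hofibMap
    (hofibMap f.f₀₀ f.f₁₀ fun i x => (congr_hom_apply f.comm_v₀ i x).symm)
    (hofibMap f.f₀₁ f.f₁₁ fun i x => (congr_hom_apply f.comm_v₁ i x).symm) ?comm)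
    (isWeakEquiv_hofibMap _ _ _ (homotopyCartesian_of_quasiIso (hom_ext_apply ?comm)
      (isWeakEquiv_hofibMap _ _ _ (homotopyCartesian_of_quasiIso f.comm_v₀.symm h₀₀ h₁₀))
      (isWeakEquiv_hofibMap _ _ _ (homotopyCartesian_of_quasiIso f.comm_v₁.symm h₀₁ h₁₁))))
  exact hofibMap_comm _ _ _ _
    (DGLA.Hom.ext_apply fun i x => (congr_hom_apply f.comm_h₀ i x).symm)
    (DGLA.Hom.ext_apply fun i x => (congr_hom_apply f.comm_h₁ i x).symm)

/-- The morphism from the kernel of `v₀` to the kernel of `v₁`. -/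
def kerHorizontal : DGLA.Hom (SubDGLA.ker S.v₀).toDGLA (SubDGLA.ker S.v₁).toDGLA :=
  (SubDGLA.ker S.v₀).restrictHom (SubDGLA.ker S.v₁) S.h₀ fun i x hx => by
    have hx' : S.v₀.toHom.f i x = 0 := hx
    change S.v₁.toHom.f i (S.h₀.toHom.f i x) = 0
    rw [← comm_apply, hx', map_zero]

/-- For `y` in the kernel of `v₁`, the pair `(0, y)` lies in the fibre product and lifts to `g₀₀`.
-/
theorem isFibration_kerHorizontal (hS : S.IsFibrant) : S.kerHorizontal.IsFibration := by
  intro i y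
  obtain ⟨z, hz, hz'⟩ := hS.2.2 i 0 ((SubDGLA.ker S.v₁).incl.toHom.f i y) (by
    rw [map_zero]
    exact ((SubDGLA.ker S.v₁).incl_mem y).symm)
  exact ⟨(SubDGLA.ker S.v₀).ofMem z hz, (SubDGLA.ker S.v₁).incl_injective hz'⟩

theorem isFibration_v₀ (hS : S.IsFibrant) : S.v₀.IsFibration := by
  intro i x
  obtain ⟨y, hy⟩ := hS.1 i (S.h₁.toHom.f i x)
  obtain ⟨z, hz, -⟩ := hS.2.2 i x y hy.symm
  exact ⟨z, hz⟩

/-- The inclusion of the double fiber into the kernel of `v₀`. -/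
def fib₂ToKer : DGLA.Hom S.fib₂ (SubDGLA.ker S.v₀).toDGLA :=
  (SubDGLA.ker S.v₀).codRestrictHom S.fib₂Sub.incl fun _ x => (S.fib₂Sub.incl_mem x).1

/-- The double fibre is the kernel of the surjection `ker v₀ → ker v₁`, hence equivalent to its
homotopy fibre. Since `v₀` and `v₁` are surjective, their kernels may in turn be replaced by their
homotopy fibres. -/
theorem homotopyEquivalent_fib₂ [CharZero K] (hS : S.IsFibrant) :
    HomotopyEquivalent S.fib₂ S.iteratedHofib := by
  have hker {L N : DGLA K} (f : DGLA.Hom L N) (i : ℤ) (x : (SubDGLA.ker f).toDGLA.cx.X i) :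
      f.toHom.f i ((SubDGLA.ker f).incl.toHom.f i x) = 0 := (SubDGLA.ker f).incl_mem x
  have hker' {L N : DGLA K} (f : DGLA.Hom L N) (hf : f.IsFibration) :
      (toHofib f (SubDGLA.ker f).incl (hker f)).IsWeakEquiv :=
    isWeakEquiv_toHofib f _ _ hf (fun i x y h => (SubDGLA.ker f).incl_injective h)
      fun i x hx => ⟨(SubDGLA.ker f).ofMem x hx, rfl⟩
  refine (HomotopyEquivalent.of_hom (toHofib S.kerHorizontal S.fib₂ToKer ?_)
    (isWeakEquiv_toHofib _ _ _ (S.isFibration_kerHorizontal hS) ?_ ?_)).trans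
    (.of_hom (hofibMap (toHofib S.v₀ _ (hker _)) (toHofib S.v₁ _ (hker _)) ?comm)
      (isWeakEquiv_hofibMap _ _ _ (homotopyCartesian_of_quasiIso (hom_ext_apply ?comm)
        (hker' _ (S.isFibration_v₀ hS)) (hker' _ hS.1))))
  · exact fun i x => (SubDGLA.ker S.v₁).incl_injective (S.fib₂Sub.incl_mem x).2
  · exact fun i x y h => S.fib₂Sub.incl_injective
      (congrArg ((SubDGLA.ker S.v₀).incl.toHom.f i) h)
  · intro i x hx
    exact ⟨S.fib₂Sub.ofMem ((SubDGLA.ker S.v₀).incl.toHom.f i x)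
      ⟨hker _ i x, congrArg ((SubDGLA.ker S.v₁).incl.toHom.f i) hx⟩, rfl⟩
  · intro i x
    refine hofib_ext rfl ?_
    exact map_zero ((pathMap S.h₁).toHom.f i).hom

theorem FibrantResolution.homotopyEquivalent_hofib₂ [CharZero K] {S : DGLASquare K}
    (R : S.FibrantResolution) : HomotopyEquivalent R.hofib₂ S.iteratedHofib :=
  (R.target.homotopyEquivalent_fib₂ R.isFibrant).trans
    (R.map.homotopyEquivalent_iteratedHofib R.isWeakEquiv).symm

end DGLASquare

end

/-! ### Homotopy fibres of maps with a complementary subcomplex -/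

noncomputable section

namespace DGLA

variable {K : Type u} [Field K]

/-- The identification of the degree `i` part of `C⟦-1⟧` with the degree `i - 1` part of `C`. -/
def unshift (C : CochainComplex (ModuleCat.{u} K) ℤ) (i : ℤ) :
    (C⟦(-1 : ℤ)⟧).X i →ₗ[K] C.X (i - 1) :=
  (tr C (by omega) : C.X (i + -1) →ₗ[K] C.X (i - 1))

theorem unshift_injective (C : CochainComplex (ModuleCat.{u} K) ℤ) (i : ℤ) :
    Function.Injective (unshift C i) := by
  have h {i j : ℤ} (h : i = j) : Function.Injective (tr C h) := by
    subst h; exact Function.injective_id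
  exact h _

theorem unshift_surjective (C : CochainComplex (ModuleCat.{u} K) ℤ) (i : ℤ) :
    Function.Surjective (unshift C i) := by
  have h {i j : ℤ} (h : i = j) : Function.Surjective (tr C h) := by
    subst h; exact Function.surjective_id
  exact h _

/-- The sign of the shifted differential agrees with the one in `d (dt x) = -dt (d x)`, so `x ↦ dt
x` commutes with differentials without further correction. -/
theorem unshift_d (C : CochainComplex (ModuleCat.{u} K) ℤ) (i j : ℤ)
    (x : (C⟦(-1 : ℤ)⟧).X i) :
    unshift C j ((C⟦(-1 : ℤ)⟧).d i j x) = -C.d (i - 1) (j - 1) (unshift C i x) := by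
  have e : (C⟦(-1 : ℤ)⟧).d i j = -C.d (i + -1) (j + -1) := by
    rw [shiftFunctor_obj_d', Int.negOnePow_neg, Int.negOnePow_one, Units.neg_smul, one_smul]
  rw [e]
  exact (map_neg (tr C _) _).trans (congrArg (- ·) ((tr_d C _ _).trans (d_tr C _ _).symm))

theorem unshift_map {C D : CochainComplex (ModuleCat.{u} K) ℤ} (φ : C ⟶ D) (i : ℤ)
    (x : (C⟦(-1 : ℤ)⟧).X i) :
    unshift D i ((φ⟦(-1 : ℤ)⟧').f i x) = φ.f (i - 1) (unshift C i x) :=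
  (hom_tr φ _ _).symm

section DtHofib

variable {B A : DGLA K} (f : Hom B A) {C : CochainComplex (ModuleCat.{u} K) ℤ} (φ : C ⟶ A.cx)

/-- The morphism `x ↦ dt φ(x)` from `C⟦-1⟧` with the trivial bracket to `A[t, dt]`. -/
def dtPath : Hom (trivialBracket (C⟦(-1 : ℤ)⟧)) A.path where
  toHom :=
    { f := fun i => ModuleCat.ofHom (A.dtMul i ∘ₗ (φ.f (i - 1)).hom ∘ₗ unshift C i)
      comm' := fun i j h => by
        refine ModuleCat.hom_ext (LinearMap.ext fun x => ?_)
        change (C⟦(-1 : ℤ)⟧).X i at x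
        change A.path.cx.d i j (A.dtMul i (φ.f (i - 1) (unshift C i x))) =
          A.dtMul j (φ.f (j - 1) (unshift C j ((C⟦(-1 : ℤ)⟧).d i j x)))
        rw [d_dtMul A i j h, unshift_d, map_neg, map_neg, hom_d_apply] }
  map_bracket i j k h x y :=
    (map_zero _).trans (bracket_dtMul A i j k h (φ.f (i - 1) (unshift C i x))
      (φ.f (j - 1) (unshift C j y))).symm

/-- The morphism `x ↦ (0, dt φ(x))` from `C⟦-1⟧` with the trivial bracket to the homotopy
fiber of `f`. -/
def dtHofib : Hom (trivialBracket (C⟦(-1 : ℤ)⟧)) (hofib f) :=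
  hofibLift f (Hom.zero _ _) (dtPath φ)
    (fun i _ => pathEval_dtMul A 0 i _)
    (fun i _ => (pathEval_dtMul A 1 i _).trans (map_zero (f.toHom.f i).hom).symm)

theorem hofibFst_dtHofib (i : ℤ) (x : (C⟦(-1 : ℤ)⟧).X i) :
    (hofibFst f).toHom.f i ((dtHofib f φ).toHom.f i x) = 0 := rfl

theorem hofibPath_dtHofib (i : ℤ) (x : (C⟦(-1 : ℤ)⟧).X i) :
    (hofibPath f).toHom.f i ((dtHofib f φ).toHom.f i x) =
      A.dtMul i (φ.f (i - 1) (unshift C i x)) := rfl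

/-- The hypotheses say that `A` is the direct sum of `f(B)` and `φ(C)`, with `f` and `φ` injective.
The homotopy fibre of `f` is then `C[-1]`, by decomposing endpoints of paths in `A`. The subcomplex
`φ(C)` need not be closed under the bracket. -/
theorem isWeakEquiv_dtHofib [CharZero K]
    (hinj : ∀ i (b : B.cx.X i) (c : C.X i), f.toHom.f i b + φ.f i c = 0 → b = 0 ∧ c = 0)
    (hsurj : ∀ i (a : A.cx.X i), ∃ (b : B.cx.X i) (c : C.X i), f.toHom.f i b + φ.f i c = a) :
    (dtHofib f φ).IsWeakEquiv := by
  refine (quasiIso_iff_forall_exists _).2 fun i j k hi hj x w hx hw => ?_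
  change (C⟦(-1 : ℤ)⟧).X k at x
  obtain rfl : j = k - 1 := eq_sub_of_add_eq hj
  obtain rfl : i = k - 1 - 1 := eq_sub_of_add_eq hi
  have hx' : C.d (k - 1) k (unshift C k x) = 0 := by
    have e := (unshift_d C k (k + 1) x).symm.trans
      ((congrArg (unshift C (k + 1)) (hx (k + 1))).trans (map_zero _))
    exact C.forall_d_eq_zero (by omega : k - 1 + 1 = k + 1 - 1) (neg_eq_zero.1 e) k
  have hw₁ : B.cx.d (k - 1) k ((hofibFst f).toHom.f (k - 1) w) = 0 := by
    rw [← hom_d_apply, ← hw]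
    rfl
  have hw₂ : A.path.cx.d (k - 1) k ((hofibPath f).toHom.f (k - 1) w) =
      A.dtMul k (φ.f (k - 1) (unshift C k x)) := by
    rw [← hom_d_apply, ← hw]
    rfl
  -- The path of `w` has differential `dt φ(x)`. As `x` is closed, `t φ(x)` has the same
  -- differential, so the difference is closed and starts at 0.
  obtain ⟨η, hη, hη₀⟩ := exists_path_primitive A (k - 1 - 1) (k - 1) hi
    ((hofibPath f).toHom.f (k - 1) w - A.line (k - 1) (φ.f (k - 1) (unshift C k x)))
    (forall_d_eq_zero _ hj (by
      rw [map_sub, hw₂, d_line A _ _ _ rfl, ← hom_d_apply, hx', map_zero, map_zero, zero_add,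
        tr_rfl, sub_self]))
    (by rw [map_sub, pathEval_zero_hofibPath, pathEval_zero_line, sub_self])
  obtain ⟨y₁, y₂, hy⟩ := hsurj _ ((A.pathEval 1).toHom.f _ η)
  -- Evaluating `d η` at 1 gives `f(b) - φ(x) = f(d y₁) + φ(d y₂)`, where `b` is the `B`-component
  -- of `w`. Directness of the sum yields `b = d y₁` and `x = -d y₂`, so `y₂` is a primitive of `x`
  -- in the shifted complex.
  obtain ⟨h₁, h₂⟩ := hinj (k - 1)
    ((hofibFst f).toHom.f (k - 1) w - B.cx.d (k - 1 - 1) (k - 1) y₁)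
    (-(unshift C k x + C.d (k - 1 - 1) (k - 1) y₂)) (by
      have e := congrArg ((A.pathEval 1).toHom.f (k - 1)) hη
      rw [hom_d_apply, ← hy, map_sub, pathEval_one_hofibPath, pathEval_one_line, map_add,
        ← hom_d_apply, ← hom_d_apply] at e
      rw [map_sub, map_neg, map_add]
      have e' := sub_eq_zero.2 e.symm
      rw [← e']
      abel)
  rw [sub_eq_zero] at h₁
  rw [neg_eq_zero, add_eq_zero_iff_neg_eq] at h₂
  obtain ⟨x', hx'₁⟩ := unshift_surjective C (k - 1) y₂
  -- Removing `t φ(y₂)` leaves the endpoint `f(y₁)`. The resulting term `-dt φ(y₂)` in the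
  -- differential is cancelled by the image of `x'`.
  have h₃ : (A.pathEval 0).toHom.f _ (η - A.line _ (φ.f _ y₂)) = 0 := by
    rw [map_sub, hη₀, pathEval_zero_line, sub_zero]
  have h₄ : (A.pathEval 1).toHom.f _ (η - A.line _ (φ.f _ y₂)) = f.toHom.f _ y₁ := by
    rw [map_sub, ← hy, pathEval_one_line, add_sub_cancel_right]
  refine ⟨x', hofibMk f y₁ _ h₃ h₄, unshift_injective C k ?_, hofib_ext ?_ ?_⟩
  · refine (unshift_d C (k - 1) k x').trans ?_
    rw [hx'₁, ← h₂, neg_neg]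
  · refine (map_add _ _ _).trans ?_
    rw [hom_d_apply, hofibFst_mk, hofibFst_dtHofib, zero_add, h₁]
  · refine (map_add _ _ _).trans ?_
    rw [hom_d_apply, hofibPath_mk, hofibPath_dtHofib, map_sub, hη, d_line A _ _ _ rfl,
      ← hom_d_apply, ← h₂, hx'₁, tr_rfl, map_neg, map_neg]
    abel

end DtHofib

/-- A morphism of complexes, as a morphism of DG-Lie algebras with trivial brackets. -/
def trivialMap {C D : CochainComplex (ModuleCat.{u} K) ℤ} (φ : C ⟶ D) :
    Hom (trivialBracket C) (trivialBracket D) where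
  toHom := φ
  map_bracket _ _ k _ _ _ := map_zero (φ.f k).hom

/-- The zero complex. -/
def zeroComplex (K : Type u) [Field K] : CochainComplex (ModuleCat.{u} K) ℤ where
  X _ := ModuleCat.of K PUnit
  d _ _ := 0

instance (i : ℤ) : Subsingleton ((zeroComplex K).X i) :=
  inferInstanceAs (Subsingleton PUnit)

/-- With `A' = 0`, the total complex is that of the short exact sequence `0 → A → B → B' → 0`. The
witnesses are a diagram chase: `v` lifts `-y'`, then `y - d v` lies in the kernel of `b` and comes
from `u`. -/
theorem homotopyCartesian_of_shortExact {A B A' B' : CochainComplex (ModuleCat.{u} K) ℤ}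
    {f : A ⟶ B} {f' : A' ⟶ B'} {a : A ⟶ A'} {b : B ⟶ B'} (hA' : ∀ i, Subsingleton (A'.X i))
    (hf : ∀ i, Function.Injective (f.f i)) (hb : ∀ i, Function.Surjective (b.f i))
    (hex : ∀ i y, b.f i y = 0 → ∃ x, f.f i x = y) :
    HomotopyCartesian f f' a b := by
  intro m i j k hm hi hj x y x' y' hx hy hx' hy'
  obtain ⟨v, hv⟩ := hb i (-y')
  have e : f'.f j x' = 0 := by rw [(hA' j).elim x' 0, map_zero]
  obtain ⟨u, hu⟩ := hex j (y - B.d i j v) (by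
    rw [map_sub, hom_d_apply, hv, map_neg, hy', e]
    abel)
  refine ⟨u, v, 0, 0, hf k ?_, by rw [hu]; abel, (hA' j).elim _ _, ?_⟩
  · rw [hom_d_apply, hu, map_sub, d_d_apply, hy, sub_zero]
  · rw [map_zero, map_zero, hv]
    abel

end DGLA

namespace DGSubspace

variable {K : Type u} [Field K] {V : CochainComplex (ModuleCat.{u} K) ℤ} (F : DGSubspace V)

/-- The inclusion of a DG-subspace. -/
def subtype : F.toComplex ⟶ V where
  f i := ModuleCat.ofHom (F.carrier i).subtype
  comm' _ _ _ := rfl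

/-- The projection to the quotient by a DG-subspace. -/
def mkQ : V ⟶ F.quotient where
  f i := ModuleCat.ofHom (F.carrier i).mkQ
  comm' _ _ _ := rfl

theorem subtype_injective (i : ℤ) : Function.Injective (F.subtype.f i) :=
  (F.carrier i).subtype_injective

theorem mkQ_surjective (i : ℤ) : Function.Surjective (F.mkQ.f i) :=
  (F.carrier i).mkQ_surjective

theorem exists_of_mkQ_eq_zero (i : ℤ) (y : V.X i) (h : F.mkQ.f i y = 0) :
    ∃ x, F.subtype.f i x = y :=
  ⟨(⟨y, (Submodule.Quotient.mk_eq_zero _).1 h⟩ : F.carrier i), rfl⟩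

end DGSubspace

end

/-! ### Affine endomorphisms as endomorphisms plus translations -/

noncomputable section

section Translation

variable {K : Type u} [Field K] (V : CochainComplex (ModuleCat.{u} K) ℤ)

variable (K) in
/-- The generator of the complex `K`. -/
def unitOne :
    ((CochainComplex.singleFunctor (ModuleCat.{u} K) 0).obj (ModuleCat.of K K)).X 0 :=
  (HomologicalComplex.singleObjXSelf (.up ℤ) 0 (ModuleCat.of K K)).inv (1 : K)

/-- The inclusion `K → V ⊕ K`. -/
def plusUnitInr :
    (CochainComplex.singleFunctor (ModuleCat.{u} K) 0).obj (ModuleCat.of K K) ⟶ plusUnit V :=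
  biprod.inr

theorem plusUnitInr_fst : plusUnitInr V ≫ plusUnitFst V = 0 := biprod.inr_fst

theorem plusUnitInr_snd : plusUnitInr V ≫ plusUnitSnd V = 𝟙 _ := biprod.inr_snd

theorem plusUnit_total :
    plusUnitFst V ≫ plusUnitInl V + plusUnitSnd V ≫ plusUnitInr V = 𝟙 _ := biprod.total

/-- The generator of the summand `K` of `V ⊕ K`. -/
def plusUnitOne : (plusUnit V).X 0 := (plusUnitInr V).f 0 (unitOne K)

variable {V}

/-- The cochain on `K` sending `1` to `x`. -/
def pointCochain {n : ℤ} (x : V.X n) :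
    Cochain ((CochainComplex.singleFunctor (ModuleCat.{u} K) 0).obj (ModuleCat.of K K)) V n :=
  Cochain.fromSingleMk (ModuleCat.ofHom (LinearMap.toSpanSingleton K (V.X n) x)) (zero_add n)

theorem pointCochain_add {n : ℤ} (x y : V.X n) :
    pointCochain (x + y) = pointCochain x + pointCochain y := by
  rw [pointCochain, LinearMap.toSpanSingleton_add, ModuleCat.ofHom_add, Cochain.fromSingleMk_add]
  rfl

theorem pointCochain_v_one {n : ℤ} (x : V.X n) :
    (pointCochain x).v 0 n (zero_add n) (unitOne K) = x := by
  rw [pointCochain, Cochain.fromSingleMk_v]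
  exact (congrArg (· • x) (ConcreteCategory.congr_hom (HomologicalComplex.singleObjXSelf
    (.up ℤ) 0 (ModuleCat.of K K)).inv_hom_id (1 : K))).trans (one_smul K x)

theorem pointCochain_surjective {n : ℤ}
    (α : Cochain ((CochainComplex.singleFunctor (ModuleCat.{u} K) 0).obj (ModuleCat.of K K))
      V n) :
    ∃ x, pointCochain x = α := by
  obtain ⟨f, rfl⟩ := Cochain.fromSingleMk_surjective α n (zero_add n)
  refine ⟨f (1 : K), ?_⟩
  rw [pointCochain]
  congr 1
  refine ModuleCat.hom_ext (LinearMap.ext_ring ?_)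
  exact one_smul K _

theorem pointCochain_smul {n : ℤ} (c : K) (x : V.X n) :
    pointCochain (c • x) = c • pointCochain x := by
  -- Every cochain on `K` is a point cochain, so it suffices to compare values at 1.
  obtain ⟨y, hy⟩ := pointCochain_surjective (c • pointCochain x)
  have e := pointCochain_v_one y
  rw [hy] at e
  rw [← hy, ← e]
  congr 1
  rw [Cochain.smul_v]
  exact congrArg (c • ·) (pointCochain_v_one x).symm

theorem δ_pointCochain (n m : ℤ) (x : V.X n) :
    δ n m (pointCochain x) = pointCochain (V.d n m x) := by
  rw [pointCochain, Cochain.δ_fromSingleMk _ _ _ _ (zero_add m), pointCochain]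
  congr 1
  refine ModuleCat.hom_ext (LinearMap.ext_ring ?_)
  exact (congrArg (V.d n m) (one_smul K x)).trans (one_smul K _).symm

variable (V)

/-- The endomorphism `(v, c) ↦ (c x, 0)` of `V ⊕ K`. -/
def translation (n : ℤ) : V.X n →ₗ[K] Cochain (plusUnit V) (plusUnit V) n where
  toFun x := ((Cochain.ofHom (plusUnitSnd V)).comp (pointCochain x) (zero_add n)).comp
    (Cochain.ofHom (plusUnitInl V)) (add_zero n)
  map_add' x y := by simp [pointCochain_add]
  map_smul' c x := by simp [pointCochain_smul]

theorem translation_v (n p q : ℤ) (h : p + n = q) (x : V.X n) :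
    (translation V n x).v p q h =
      (plusUnitSnd V).f p ≫ (pointCochain x).v p q h ≫ (plusUnitInl V).f q := by
  simp [translation]

theorem δ_translation (n m : ℤ) (x : V.X n) :
    δ n m (translation V n x) = translation V m (V.d n m x) := by
  simp [translation, δ_pointCochain]

theorem snd_translation (n p q : ℤ) (h : p + n = q) (x : V.X n) (w : (plusUnit V).X p) :
    (plusUnitSnd V).f q ((translation V n x).v p q h w) = 0 := by
  have e : (plusUnitInl V).f q ≫ (plusUnitSnd V).f q = 0 := by
    rw [← HomologicalComplex.comp_f, plusUnitInl_snd, HomologicalComplex.zero_f]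
  rw [translation_v, ← ModuleCat.comp_apply]
  simp only [Category.assoc, e, comp_zero]
  rfl

theorem fst_translation (n p q : ℤ) (h : p + n = q) (x : V.X n) (w : (plusUnit V).X p) :
    (plusUnitFst V).f q ((translation V n x).v p q h w) =
      (pointCochain x).v p q h ((plusUnitSnd V).f p w) := by
  have e : (plusUnitInl V).f q ≫ (plusUnitFst V).f q = 𝟙 _ := by
    rw [← HomologicalComplex.comp_f, plusUnitInl_fst, HomologicalComplex.id_f]
  rw [translation_v, ← ModuleCat.comp_apply]
  simp only [Category.assoc, e, Category.comp_id]
  rfl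

theorem pointCochain_v_mem (F : DGSubspace V) (n p q : ℤ) (h : p + n = q) (x : V.X n)
    (hx : x ∈ F.carrier n)
    (w : ((CochainComplex.singleFunctor (ModuleCat.{u} K) 0).obj (ModuleCat.of K K)).X p) :
    (pointCochain x).v p q h w ∈ F.carrier q := by
  by_cases hp : p = 0
  · subst hp
    obtain rfl : n = q := by omega
    rw [pointCochain, Cochain.fromSingleMk_v]
    exact (F.carrier n).smul_mem _ hx
  · rw [pointCochain, Cochain.fromSingleMk_v_eq_zero _ _ _ _ _ hp]
    exact (F.carrier q).zero_mem

theorem translation_mem_affSub (n : ℤ) (x : V.X n) :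
    translation V n x ∈ (affSub V).carrier n :=
  fun p q h w _ => snd_translation V n p q h x w

theorem translation_mem_affPairSub (F : DGSubspace V) (n : ℤ) (x : V.X n)
    (hx : x ∈ F.carrier n) : translation V n x ∈ (affPairSub V F).carrier n :=
  ⟨translation_mem_affSub V n x, fun p q h w _ =>
    ⟨(congrArg (· ∈ F.carrier q) (fst_translation V n p q h x w)).mpr
      (pointCochain_v_mem V F n p q h x hx _), snd_translation V n p q h x w⟩⟩

theorem fst_plusUnitOne : (plusUnitFst V).f 0 (plusUnitOne V) = 0 := by
  have e : (plusUnitInr V).f 0 ≫ (plusUnitFst V).f 0 = 0 := by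
    rw [← HomologicalComplex.comp_f, plusUnitInr_fst, HomologicalComplex.zero_f]
  exact ConcreteCategory.congr_hom e (unitOne K)

theorem fst_translation_one (n : ℤ) (x : V.X n) :
    (plusUnitFst V).f n ((translation V n x).v 0 n (zero_add n) (plusUnitOne V)) = x := by
  have e : (plusUnitInr V).f 0 ≫ (plusUnitSnd V).f 0 = 𝟙 _ := by
    rw [← HomologicalComplex.comp_f, plusUnitInr_snd, HomologicalComplex.id_f]
  rw [fst_translation]
  exact (congrArg ((pointCochain x).v 0 n (zero_add n))
    (ConcreteCategory.congr_hom e (unitOne K))).trans (pointCochain_v_one x)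

theorem fst_extendCochain_one (n : ℤ) (b : Cochain V V n) :
    (plusUnitFst V).f n ((extendCochain V n b).v 0 n (zero_add n) (plusUnitOne V)) = 0 := by
  rw [fst_extendCochain, fst_plusUnitOne, map_zero]

theorem fst_extendCochain_inl (n p q : ℤ) (h : p + n = q) (b : Cochain V V n) (v : V.X p) :
    (plusUnitFst V).f q ((extendCochain V n b).v p q h ((plusUnitInl V).f p v)) =
      b.v p q h v := by
  have e : (plusUnitInl V).f p ≫ (plusUnitFst V).f p = 𝟙 _ := by
    rw [← HomologicalComplex.comp_f, plusUnitInl_fst, HomologicalComplex.id_f]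
  rw [fst_extendCochain, ← ModuleCat.comp_apply ((plusUnitInl V).f p), e]
  rfl

theorem fst_translation_inl (n p q : ℤ) (h : p + n = q) (x : V.X n) (v : V.X p) :
    (plusUnitFst V).f q ((translation V n x).v p q h ((plusUnitInl V).f p v)) = 0 := by
  have e : (plusUnitInl V).f p ≫ (plusUnitSnd V).f p = 0 := by
    rw [← HomologicalComplex.comp_f, plusUnitInl_snd, HomologicalComplex.zero_f]
  rw [fst_translation, ← ModuleCat.comp_apply ((plusUnitInl V).f p), e]
  exact map_zero _

/-- On the summand `V` only `b` acts, and on the generator of `K` only the translation does. -/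
theorem eq_zero_of_extendCochain_add_translation (n : ℤ) (b : Cochain V V n) (x : V.X n)
    (h : extendCochain V n b + translation V n x = 0) : b = 0 ∧ x = 0 := by
  have key (p q : ℤ) (hpq : p + n = q) (w : (plusUnit V).X p) :
      (plusUnitFst V).f q ((extendCochain V n b).v p q hpq w) +
        (plusUnitFst V).f q ((translation V n x).v p q hpq w) = 0 := by
    rw [← map_add]
    exact (congrArg (fun ξ : Cochain (plusUnit V) (plusUnit V) n =>
      (plusUnitFst V).f q (ξ.v p q hpq w)) h).trans (map_zero _)
  constructor
  · ext p q hpq v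
    have e := key p q hpq ((plusUnitInl V).f p v)
    rwa [fst_extendCochain_inl, fst_translation_inl, add_zero] at e
  · have e := key 0 n (zero_add n) (plusUnitOne V)
    rwa [fst_extendCochain_one, fst_translation_one, zero_add] at e

/-- Since `ξ` lands in `V`, it is determined by its `V`-component. Restricting that component to the
two summands of the source gives `b` and the cochain represented by `x`. -/
theorem exists_extendCochain_add_translation (n : ℤ)
    (ξ : Cochain (plusUnit V) (plusUnit V) n) (hξ : ξ ∈ (affSub V).carrier n) :
    ∃ b x, extendCochain V n b + translation V n x = ξ := by
  have hsnd : ξ.comp (Cochain.ofHom (plusUnitSnd V)) (add_zero n) = 0 := by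
    ext p q hpq w
    rw [Cochain.comp_zero_cochain_v, Cochain.ofHom_v]
    exact hξ p q hpq w trivial
  have h₁ : (ξ.comp (Cochain.ofHom (plusUnitFst V)) (add_zero n)).comp
      (Cochain.ofHom (plusUnitInl V)) (add_zero n) = ξ := by
    have e := congrArg (fun φ => ξ.comp (Cochain.ofHom φ) (add_zero n)) (plusUnit_total V)
    simp only [Cochain.ofHom_add, Cochain.ofHom_comp, Cochain.comp_add, Cochain.comp_id] at e
    rw [← Cochain.comp_assoc_of_second_is_zero_cochain,
      ← Cochain.comp_assoc_of_second_is_zero_cochain, hsnd, Cochain.zero_comp, add_zero] at e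
    exact e
  obtain ⟨x, hx⟩ := pointCochain_surjective (((Cochain.ofHom (plusUnitInr V)).comp ξ
    (zero_add n)).comp (Cochain.ofHom (plusUnitFst V)) (add_zero n))
  refine ⟨((Cochain.ofHom (plusUnitInl V)).comp ξ (zero_add n)).comp
    (Cochain.ofHom (plusUnitFst V)) (add_zero n), x, ?_⟩
  have e := congrArg (fun φ => (Cochain.ofHom φ).comp ξ (zero_add n)) (plusUnit_total V)
  simp only [Cochain.ofHom_add, Cochain.ofHom_comp, Cochain.add_comp, Cochain.id_comp] at e
  change extendCochain V n _ + ((Cochain.ofHom (plusUnitSnd V)).comp (pointCochain x)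
    (zero_add n)).comp (Cochain.ofHom (plusUnitInl V)) (add_zero n) = ξ
  rw [hx, extendCochain]
  conv_rhs => rw [← h₁, ← e]
  simp only [Cochain.add_comp, Cochain.comp_assoc_of_first_is_zero_cochain,
    Cochain.comp_assoc_of_third_is_zero_cochain]

/-- Both memberships are tested on elements of `F ⊕ K`: vectors of `F` detect `b`, and the generator
of `K`, whose `V`-component is zero, detects `x`. -/
theorem mem_of_extendCochain_add_translation (F : DGSubspace V) (n : ℤ) (b : Cochain V V n)
    (x : V.X n)
    (h : extendCochain V n b + translation V n x ∈ (affPairSub V F).carrier n) :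
    b ∈ (endSub V F).carrier n ∧ x ∈ F.carrier n := by
  have key (p q : ℤ) (hpq : p + n = q) (w : (plusUnit V).X p)
      (hw : (plusUnitFst V).f p w ∈ F.carrier p) :
      (plusUnitFst V).f q ((extendCochain V n b).v p q hpq w) +
        (plusUnitFst V).f q ((translation V n x).v p q hpq w) ∈ F.carrier q := by
    rw [← map_add]
    exact (h.2 p q hpq w hw).1
  constructor
  · intro p q hpq v hv
    have e : (plusUnitInl V).f p ≫ (plusUnitFst V).f p = 𝟙 _ := by
      rw [← HomologicalComplex.comp_f, plusUnitInl_fst, HomologicalComplex.id_f]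
    have e' := key p q hpq ((plusUnitInl V).f p v) (by
      rw [← ModuleCat.comp_apply, e]
      exact hv)
    rwa [fst_extendCochain_inl, fst_translation_inl, add_zero] at e'
  · have e := key 0 n (zero_add n) (plusUnitOne V) (by
      rw [fst_plusUnitOne]
      exact zero_mem _)
    rwa [fst_extendCochain_one, fst_translation_one, zero_add] at e

/-- Translations, as a morphism of complexes from `V` to `Aff(V)`. -/
def translationHom : V ⟶ (affSub V).toDGLA.cx where
  f n := ModuleCat.ofHom ((translation V n).codRestrict ((affSub V).carrier n)
    (translation_mem_affSub V n))
  comm' i j _ := by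
    ext x
    exact Subtype.ext (δ_translation V i j x)

/-- Translations, as a morphism of complexes from `F` to `Aff(V; F)`. -/
def translationPairHom (F : DGSubspace V) : F.toComplex ⟶ (affPairSub V F).toDGLA.cx where
  f n := ModuleCat.ofHom ((translation V n).restrict (translation_mem_affPairSub V F n))
  comm' i j _ := by
    ext x
    exact Subtype.ext (δ_translation V i j x.1)

end Translation

end

/-! ### The homotopy fibres of the Jacobian square -/

noncomputable section

namespace DGLA

variable {K : Type u} [Field K]

section

variable [CharZero K] (V : CochainComplex (ModuleCat.{u} K) ℤ) (F : DGSubspace V)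

theorem isWeakEquiv_dtHofib_translationHom :
    (dtHofib (jacobianSquare V F).v₁ (translationHom V)).IsWeakEquiv := by
  refine isWeakEquiv_dtHofib _ _ (fun i b c h => ?_) (fun i a => ?_)
  · exact eq_zero_of_extendCochain_add_translation V i b c (congrArg Subtype.val h)
  · obtain ⟨b, x, h⟩ := exists_extendCochain_add_translation V i _ ((affSub V).incl_mem a)
    exact ⟨b, x, (affSub V).incl_injective h⟩

theorem isWeakEquiv_dtHofib_translationPairHom :
    (dtHofib (jacobianSquare V F).v₀ (translationPairHom V F)).IsWeakEquiv := by
  refine isWeakEquiv_dtHofib _ _ (fun i b c h => ?_) (fun i a => ?_)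
  · obtain ⟨h₁, h₂⟩ := eq_zero_of_extendCochain_add_translation V i
      ((endSub V F).incl.toHom.f i b) (F.subtype.f i c) (congrArg Subtype.val h)
    exact ⟨Subtype.ext h₁, Subtype.ext h₂⟩
  · have ha := (affPairSub V F).incl_mem a
    obtain ⟨b, x, h⟩ := exists_extendCochain_add_translation V i _ ha.1
    rw [← h] at ha
    obtain ⟨hb, hx⟩ := mem_of_extendCochain_add_translation V F i b x ha
    exact ⟨(endSub V F).ofMem b hb, (⟨x, hx⟩ : F.carrier i), (affPairSub V F).incl_injective h⟩

/-- The inclusion `F⟦-1⟧ → V⟦-1⟧`, with trivial brackets. -/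
def shiftInclusion :
    Hom (trivialBracket (F.toComplex⟦(-1 : ℤ)⟧)) (trivialBracket (V⟦(-1 : ℤ)⟧)) :=
  trivialMap (F.subtype⟦(-1 : ℤ)⟧')

/-- A translation by a vector of `F` is the same endomorphism in `Aff(V; F)` and in `Aff(V)`. The
equivalences `F[-1] → hofib v₀` and `V[-1] → hofib v₁` therefore form a strictly commutative square,
and homotopy fibres can be compared. -/
theorem homotopyEquivalent_iteratedHofib_jacobianSquare :
    HomotopyEquivalent (hofib (shiftInclusion V F)) (jacobianSquare V F).iteratedHofib := by
  have comm (i : ℤ) (x : (F.toComplex⟦(-1 : ℤ)⟧).X i) :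
      (jacobianSquare V F).hofibHorizontal.toHom.f i
        ((dtHofib (jacobianSquare V F).v₀ (translationPairHom V F)).toHom.f i x) =
      (dtHofib (jacobianSquare V F).v₁ (translationHom V)).toHom.f i
        ((shiftInclusion V F).toHom.f i x) := by
    refine hofib_ext (map_zero ((jacobianSquare V F).h₀.toHom.f i).hom) ?_
    refine (pathMap_dtMul (jacobianSquare V F).h₁ i _).trans ?_
    exact congrArg (fun y => (jacobianSquare V F).g₁₁.dtMul i ((translationHom V).f (i - 1) y))
      (unshift_map F.subtype i x).symm
  exact .of_hom (hofibMap _ _ comm) (isWeakEquiv_hofibMap _ _ _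
    (homotopyCartesian_of_quasiIso (hom_ext_apply comm)
      (isWeakEquiv_dtHofib_translationPairHom V F) (isWeakEquiv_dtHofib_translationHom V F)))

/-- The short exact sequence `0 → F[-1] → V[-1] → (V/F)[-1] → 0` makes the square from `F[-1] →
V[-1]` to `0 → (V/F)[-1]` homotopy cartesian. -/
theorem homotopyEquivalent_hofib_shiftInclusion :
    HomotopyEquivalent (hofib (shiftInclusion V F)) (hofib (Hom.zero
      (trivialBracket (zeroComplex K)) (trivialBracket (F.quotient⟦(-1 : ℤ)⟧)))) := by
  have comm (i : ℤ) (x : (F.toComplex⟦(-1 : ℤ)⟧).X i) :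
      (F.mkQ⟦(-1 : ℤ)⟧').f i ((shiftInclusion V F).toHom.f i x) = 0 :=
    (Submodule.Quotient.mk_eq_zero _).2 (Subtype.property (p := (· ∈ F.carrier (i + -1))) x)
  exact .of_hom (hofibMap (Hom.zero _ _) (trivialMap (F.mkQ⟦(-1 : ℤ)⟧'))
      fun i x => (comm i x).symm)
    (isWeakEquiv_hofibMap _ _ _ (homotopyCartesian_of_shortExact
      (fun i => inferInstanceAs (Subsingleton ((zeroComplex K).X i)))
      (fun i => F.subtype_injective (i + -1)) (fun i => F.mkQ_surjective (i + -1))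
      (fun i => F.exists_of_mkQ_eq_zero (i + -1))))

end

/-- This is `isWeakEquiv_dtHofib` for `B = 0` and `φ` the identity: the loop object of `C` is
`C[-1]`. -/
theorem homotopyEquivalent_hofib_zero [CharZero K]
    (C : CochainComplex (ModuleCat.{u} K) ℤ) :
    HomotopyEquivalent (trivialBracket (C⟦(-1 : ℤ)⟧))
      (hofib (Hom.zero (trivialBracket (zeroComplex K)) (trivialBracket C))) :=
  .of_hom (dtHofib _ (𝟙 C)) (isWeakEquiv_dtHofib _ _
    (fun i b c h => ⟨Subsingleton.elim (α := (zeroComplex K).X i) b 0,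
      (zero_add (c : C.X i)).symm.trans h⟩)
    (fun i a => ⟨(0 : (zeroComplex K).X i), a, zero_add (a : C.X i)⟩))

theorem homotopyEquivalent_shift_shift (C : CochainComplex (ModuleCat.{u} K) ℤ) :
    HomotopyEquivalent (trivialBracket (C⟦(-1 : ℤ)⟧⟦(-1 : ℤ)⟧))
      (trivialBracket (C⟦(-2 : ℤ)⟧)) :=
  let e : C⟦(-1 : ℤ)⟧⟦(-1 : ℤ)⟧ ≅ C⟦(-2 : ℤ)⟧ :=
    ((CategoryTheory.shiftFunctorAdd' (CochainComplex (ModuleCat.{u} K) ℤ)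
      (-1) (-1) (-2) (by norm_num : (-1 : ℤ) + -1 = -2)).app C).symm
  .of_hom (trivialMap e.hom) (inferInstanceAs (QuasiIso e.hom))

end DGLA

end

theorem mainTheorem3 {K : Type u} [Field K] [CharZero K]
    (V : CochainComplex (ModuleCat.{u} K) ℤ) (F : DGSubspace V) :
    Nonempty (jacobianSquare V F).FibrantResolution ∧
    ∀ R : (jacobianSquare V F).FibrantResolution,
      R.hofib₂.IsHomotopyAbelian ∧
      DGLA.HomotopyEquivalent R.hofib₂ (DGLA.trivialBracket (F.quotient⟦(-2 : ℤ)⟧)) := by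
  refine ⟨⟨(jacobianSquare V F).fibrantResolution⟩, fun R => ?_⟩
  have h : DGLA.HomotopyEquivalent R.hofib₂
      (DGLA.trivialBracket (F.quotient⟦(-2 : ℤ)⟧)) :=
    R.homotopyEquivalent_hofib₂.trans <|
      (DGLA.homotopyEquivalent_iteratedHofib_jacobianSquare V F).symm.trans <|
      (DGLA.homotopyEquivalent_hofib_shiftInclusion V F).trans <|
      (DGLA.homotopyEquivalent_hofib_zero _).symm.trans <|
      DGLA.homotopyEquivalent_shift_shift _
  exact ⟨⟨DGLA.trivialBracket _, fun _ _ _ _ => rfl, h⟩, h⟩
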